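/- **Theorem (Upper bound).** Let $P\subset\mathbb{R}^3$ be a polyhedron, that is, a compact connected set whose boundary is a (closed) piecewise linear $2$-manifold. Let $\Sigma$ be a tetrahedral decomposition of $P$ into $m=|\Sigma|$ tetrahedra: a finite set of nondegenerate tetrahedra whose union is $P$ and any two of which meet in a common face (a facet, an edge or a vertex) or not at all. (Steiner points are allowed: the vertices of the tetrahedra may be arbitrary points of $P$.) Then there is a set $B\subset P$ of at most $\left\lfloor\frac{m+1}{3}\right\rfloor$ beacons such that for all $p,q\in P$ the point $p$ can be routed via the beacons in $B$ towards $q$. Here a point attracted by a beacon $b\in P$ moves inside $P$ along a polygonal attraction path: at every moment it moves in the direction that, among all directions in which it can move without leaving $P$, decreases its distance to $b$ most rapidly, until it is stuck, i.e. no feasible direction decreases the distance to $b$. The beacon $b$ *covers* $p$ if the attraction path of $p$ towards $b$ ends in $b$ (for every choice of the direction wherever it is not unique). The point $p$ *can be routed via $B$ towards $q$* if there are $k\ge 1$ and a sequence $b_1,\dots,b_k$ with $b_k=q$ and $b_1,\dots,b_{k-1}\in B$ such that $b_1$ covers $p$ and $b_{i+1}$ covers $b_i$ for all $1\le i<k$.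 -/

import Mathlib

namespace Beacon

/-- Three-dimensional Euclidean space. -/
abbrev Space3 : Type := EuclideanSpace ℝ (Fin 3)

/-- The vertex sets of finitely many nondegenerate simplices with `n` vertices each, any two of
which meet in the convex hull of their common vertices (that is, in a common face or not at all):
the top-dimensional simplices of a finite pure simplicial complex. -/
structure IsSimplicialFamily (n : ℕ) (F : Finset (Finset Space3)) : Prop where
  card_eq : ∀ s ∈ F, s.card = n
  indep : ∀ s ∈ F, AffineIndependent ℝ ((↑) : s → Space3)
  inter_subset : ∀ s ∈ F, ∀ t ∈ F,
    convexHull ℝ (s : Set Space3) ∩ convexHull ℝ (t : Set Space3) ⊆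
      convexHull ℝ ((s : Set Space3) ∩ (t : Set Space3))

/-- The union of the simplices with the given vertex sets. -/
def carrier (F : Finset (Finset Space3)) : Set Space3 :=
  ⋃ s ∈ F, convexHull ℝ (s : Set Space3)

/-- A closed (compact, without boundary) piecewise linear 2-manifold in space: a set triangulated
by finitely many triangles such that every edge lies in exactly two triangles and the triangles at
every vertex are connected to each other through edges at this vertex (so that the link of every
vertex is a single cycle). It need not be connected. -/
def IsClosedPLSurface (M : Set Space3) : Prop :=
  ∃ T : Finset (Finset Space3),
    IsSimplicialFamily 3 T ∧ carrier T = M ∧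
    (∀ e : Finset Space3, e.card = 2 → (∃ s ∈ T, e ⊆ s) → {s | s ∈ T ∧ e ⊆ s}.ncard = 2) ∧
    (∀ v : Space3, ∀ s ∈ T, ∀ t ∈ T, v ∈ s → v ∈ t →
      Relation.ReflTransGen
        (fun a b : Finset Space3 => a ∈ T ∧ b ∈ T ∧ v ∈ a ∧ v ∈ b ∧
          ((a : Set Space3) ∩ (b : Set Space3)).ncard = 2) s t)

/-- A polyhedron: a compact connected set bounded by a piecewise linear 2-manifold. -/
structure IsPolyhedron (P : Set Space3) : Prop where
  isCompact : IsCompact P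
  isConnected : IsConnected P
  boundary : IsClosedPLSurface (frontier P)

/-- A tetrahedral decomposition of `P`, given by the vertex sets of its tetrahedra. The vertices
are arbitrary points, so Steiner points are allowed. -/
structure IsTetrahedralDecomposition (P : Set Space3) (F : Finset (Finset Space3)) : Prop where
  simplicial : IsSimplicialFamily 4 F
  carrier_eq : carrier F = P

/-- From `x`, one can move a little in the direction `v` without leaving `P`. -/
def IsFeasibleDirection (P : Set Space3) (x v : Space3) : Prop :=
  ∃ ε : ℝ, 0 < ε ∧ ∀ t : ℝ, 0 ≤ t → t ≤ ε → x + t • v ∈ P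

/-- `v` is a feasible unit direction at `x` along which the distance to `b` decreases, and
decreases most rapidly among all feasible unit directions. Here the distance to `b`
decreases in the unit direction `v` at the rate `⟪b - x, v⟫ / ‖b - x‖`. -/
def IsSteepestDirection (P : Set Space3) (b x v : Space3) : Prop :=
  ‖v‖ = 1 ∧ IsFeasibleDirection P x v ∧ 0 < inner ℝ (b - x) v ∧
    ∀ w : Space3, ‖w‖ = 1 → IsFeasibleDirection P x w →
      inner ℝ (b - x) w ≤ inner ℝ (b - x) v

/-- A point in `P` attracted by `b` can move along the straight segment from `x` to `y`: at
every point of the segment before `y`, its direction is one of steepest decrease of the distance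
to `b`. -/
def AttractionStep (P : Set Space3) (b x y : Space3) : Prop :=
  ∃ (v : Space3) (r : ℝ), 0 < r ∧ y = x + r • v ∧
    ∀ t : ℝ, 0 ≤ t → t < r → IsSteepestDirection P b (x + t • v) v

/-- A point attracted by `b` is stuck at `x` if it cannot decrease its distance to `b`.
In particular it comes to rest at `b` itself. -/
def IsStuck (P : Set Space3) (b x : Space3) : Prop :=
  ¬ ∃ v : Space3, IsFeasibleDirection P x v ∧ 0 < inner ℝ (b - x) v

/-- Some attraction path of `p` towards `b` (a polygonal path each of whose segments is an
attraction step, followed until no further decrease of the distance is possible) ends in `y`. -/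
def AttractionPathEndsAt (P : Set Space3) (b p y : Space3) : Prop :=
  Relation.ReflTransGen (AttractionStep P b) p y ∧ IsStuck P b y

/-- The beacon `b` covers `p`: the attraction path of `p` towards `b` ends in `b`. Where the
direction of steepest decrease is ambiguous, all choices are required to end in `b`. -/
def Covers (P : Set Space3) (b p : Space3) : Prop :=
  AttractionPathEndsAt P b p b ∧ ∀ y : Space3, AttractionPathEndsAt P b p y → y = b

/-- With beacons at the points of `B`, the point `p` can be routed towards `q`: there is a
sequence `b₁, …, bₖ = q` with `b₁, …, bₖ₋₁` in `B` such that `b₁` covers `p` and every `bᵢ₊₁`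
covers `bᵢ`. (The target `q` itself acts as the last beacon.) -/
def CanRoute (P : Set Space3) (B : Finset Space3) (p q : Space3) : Prop :=
  ∃ l : List Space3, (∀ b ∈ l, b ∈ B) ∧
    List.IsChain (fun x y => Covers P y x) (p :: (l ++ [q]))

end Beacon

/-! ### Attraction towards a visible beacon -/

namespace Beacon

/-! A beacon covers every point it sees, and any two points of a tetrahedron see each other. So it
suffices to find few vertices that meet every tetrahedron and are linked to each other through
common tetrahedra (`IsConnectedTransversal`).

Such vertices come from a tree of tetrahedra glued along facets. Below a node, let `r` be the number
of tetrahedra, between 1 and 3, not yet paid for at three per vertex. The subtree then only asks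
that one of at least `4 - r` vertices of the facet shared with the parent be chosen. Inside the four
vertices of the parent such demands can be met at the same price (`hasCheapHitting`), which gives
`IsFacetTree.exists_transversal` by induction. Applied to all tetrahedra but one leaf, with the
facet towards the leaf distinguished, it leaves one extra vertex to pay for, hence `(m + 1) / 3`.

The tree exists because the tetrahedra are connected through facets
(`IsTetrahedralDecomposition.exists_common_facet`). Otherwise the polyhedron is the union of two
regular closed sets meeting only in finitely many lines. Lines do not separate space locally, so the
frontiers of both sets lie in the boundary surface, and each boundary triangle belongs to exactly
one set. Triangles sharing an edge belong to the same set, since a half-plane does not separate a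
ball either. As the triangles at a vertex are connected through edges, the two sets are disjoint
(`IsThinPair.inter_eq_empty`), against the connectedness of the polyhedron. -/

theorem isFeasibleDirection_sub_of_segment_subset {P : Set Space3} {x b : Space3}
    (h : segment ℝ x b ⊆ P) {c : ℝ} (hc : 0 < c) : IsFeasibleDirection P x (c • (b - x)) := by
  refine ⟨c⁻¹, inv_pos.2 hc, fun t ht0 ht => h ?_⟩
  rw [segment_eq_image']
  refine ⟨t * c, ⟨by positivity, ?_⟩, by simp only [mul_smul]⟩
  calc t * c ≤ c⁻¹ * c := by gcongr
    _ = 1 := inv_mul_cancel₀ hc.ne'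

theorem isStuck_self (P : Set Space3) (b : Space3) : IsStuck P b b := by
  rintro ⟨v, -, hv⟩
  simp at hv

theorem eq_of_isStuck_of_segment_subset {P : Set Space3} {x b : Space3}
    (h : segment ℝ x b ⊆ P) (hs : IsStuck P b x) : x = b := by
  by_contra hne
  refine hs ⟨(1 : ℝ) • (b - x), isFeasibleDirection_sub_of_segment_subset h one_pos, ?_⟩
  rw [one_smul]
  exact real_inner_self_pos.2 (sub_ne_zero.2 (Ne.symm hne))

/-- Where the beacon is visible, the direction of steepest decrease points straight to it. -/
theorem IsSteepestDirection.eq_of_segment_subset {P : Set Space3} {x b v : Space3}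
    (h : segment ℝ x b ⊆ P) (hv : IsSteepestDirection P b x v) : v = ‖b - x‖⁻¹ • (b - x) := by
  obtain ⟨hv1, -, hpos, hmax⟩ := hv
  have hne : b - x ≠ 0 := by
    rintro h0
    simp [h0] at hpos
  have hn : 0 < ‖b - x‖ := norm_pos_iff.2 hne
  have hle := hmax (‖b - x‖⁻¹ • (b - x)) (by
    rw [norm_smul, norm_inv, norm_norm, inv_mul_cancel₀ hn.ne'])
    (isFeasibleDirection_sub_of_segment_subset h (inv_pos.2 hn))
  rw [inner_smul_right, real_inner_self_eq_norm_sq] at hle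
  -- Comparison with the direction straight to `b` forces equality in Cauchy–Schwarz.
  have heq : inner ℝ (b - x) v = ‖b - x‖ * ‖v‖ := by
    apply le_antisymm (real_inner_le_norm _ _)
    rw [hv1, mul_one]
    calc ‖b - x‖ = ‖b - x‖⁻¹ * ‖b - x‖ ^ 2 := by field_simp
      _ ≤ _ := hle
  rw [inner_eq_norm_mul_iff_real, hv1, one_smul] at heq
  conv_rhs => rw [heq, norm_smul, norm_norm, hv1, mul_one, smul_smul, inv_mul_cancel₀ hn.ne', one_smul]

theorem isSteepestDirection_of_segment_subset {P : Set Space3} {x b : Space3}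
    (h : segment ℝ x b ⊆ P) (hne : x ≠ b) :
    IsSteepestDirection P b x (‖b - x‖⁻¹ • (b - x)) := by
  have hn : 0 < ‖b - x‖ := norm_pos_iff.2 (sub_ne_zero.2 hne.symm)
  have hin : inner ℝ (b - x) (‖b - x‖⁻¹ • (b - x)) = ‖b - x‖ := by
    rw [inner_smul_right, real_inner_self_eq_norm_sq]
    field_simp
  refine ⟨?_, isFeasibleDirection_sub_of_segment_subset h (inv_pos.2 hn), by rwa [hin], ?_⟩
  · rw [norm_smul, norm_inv, norm_norm, inv_mul_cancel₀ hn.ne']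
  · intro w hw _
    rw [hin]
    simpa [hw] using real_inner_le_norm (b - x) w

theorem segment_subset_of_mem_segment {x b z : Space3} (hz : z ∈ segment ℝ x b) :
    segment ℝ z b ⊆ segment ℝ x b :=
  (convex_segment x b).segment_subset hz (right_mem_segment ℝ x b)

theorem attractionStep_of_segment_subset {P : Set Space3} {x b : Space3}
    (h : segment ℝ x b ⊆ P) (hne : x ≠ b) : AttractionStep P b x b := by
  have hn : 0 < ‖b - x‖ := norm_pos_iff.2 (sub_ne_zero.2 hne.symm)
  refine ⟨‖b - x‖⁻¹ • (b - x), ‖b - x‖, hn, ?_, fun t ht0 ht => ?_⟩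
  · rw [smul_smul, mul_inv_cancel₀ hn.ne', one_smul, add_sub_cancel]
  · have hlt : t * ‖b - x‖⁻¹ < 1 := by
      rw [← div_eq_mul_inv, div_lt_one hn]; exact ht
    have hz : x + t • ‖b - x‖⁻¹ • (b - x) ∈ segment ℝ x b := by
      rw [segment_eq_image']
      exact ⟨t * ‖b - x‖⁻¹, ⟨by positivity, hlt.le⟩, by simp only [mul_smul]⟩
    set z := x + t • ‖b - x‖⁻¹ • (b - x) with hzdef
    have hsub : b - z = (1 - t * ‖b - x‖⁻¹) • (b - x) := by
      rw [hzdef, smul_smul]; module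
    have hpos : 0 < 1 - t * ‖b - x‖⁻¹ := by linarith
    have hzne : z ≠ b := by
      intro hzb
      rw [hzb, sub_self] at hsub
      exact (smul_ne_zero hpos.ne' (sub_ne_zero.2 hne.symm)) hsub.symm
    have hst := isSteepestDirection_of_segment_subset
      ((segment_subset_of_mem_segment hz).trans h) hzne
    have : ‖b - z‖⁻¹ • (b - z) = ‖b - x‖⁻¹ • (b - x) := by
      rw [hsub, norm_smul, Real.norm_of_nonneg hpos.le, smul_smul]
      congr 1
      rw [mul_inv, mul_right_comm, inv_mul_cancel₀ hpos.ne', one_mul]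
    rwa [this] at hst

theorem AttractionStep.mem_segment {P : Set Space3} {x y b : Space3}
    (h : segment ℝ x b ⊆ P) (hs : AttractionStep P b x y) : y ∈ segment ℝ x b := by
  obtain ⟨v, r, hr, rfl, hv⟩ := hs
  have h0 := hv 0 le_rfl hr
  rw [zero_smul, add_zero] at h0
  have hve := h0.eq_of_segment_subset h
  have hne : b - x ≠ 0 := by
    rintro h0'
    have := h0.2.2.1
    simp [h0'] at this
  have hn : 0 < ‖b - x‖ := norm_pos_iff.2 hne
  -- Overshooting would require a strictly decreasing direction at `b` itself.
  have hrn : r ≤ ‖b - x‖ := by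
    by_contra! hlt
    have := (hv _ hn.le hlt).2.2.1
    rw [hve, smul_smul, mul_inv_cancel₀ hn.ne', one_smul, add_sub_cancel, sub_self,
      inner_zero_left] at this
    exact lt_irrefl _ this
  rw [segment_eq_image']
  refine ⟨r * ‖b - x‖⁻¹, ⟨by positivity, ?_⟩, by simp only [hve, mul_smul]⟩
  rw [← div_eq_mul_inv, div_le_one hn]
  exact hrn

/-- A beacon covers every point that it sees. -/
theorem covers_of_segment_subset {P : Set Space3} {p b : Space3} (h : segment ℝ p b ⊆ P) :
    Covers P b p := by
  refine ⟨⟨?_, isStuck_self P b⟩, ?_⟩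
  · rcases eq_or_ne p b with rfl | hne
    · exact .refl
    · exact .single (attractionStep_of_segment_subset h hne)
  · rintro y ⟨hpath, hstuck⟩
    have hy : y ∈ segment ℝ p b := by
      clear hstuck
      induction hpath with
      | refl => exact left_mem_segment ℝ p b
      | tail _ hstep ih =>
        exact segment_subset_of_mem_segment ih
          (hstep.mem_segment ((segment_subset_of_mem_segment ih).trans h))
    exact eq_of_isStuck_of_segment_subset ((segment_subset_of_mem_segment hy).trans h) hstuck

theorem canRoute_of_covers {P : Set Space3} {B : Finset Space3} {p q : Space3}
    (h : Covers P q p) : CanRoute P B p q :=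
  ⟨[], by simp, by simpa using h⟩

theorem CanRoute.of_covers {P : Set Space3} {B : Finset Space3} {p b q : Space3}
    (hb : b ∈ B) (h : Covers P b p) (hr : CanRoute P B b q) : CanRoute P B p q := by
  obtain ⟨l, hl, hc⟩ := hr
  refine ⟨b :: l, ?_, ?_⟩
  · simpa [hb] using hl
  · rw [List.cons_append, List.isChain_cons_cons]
    exact ⟨h, hc⟩

end Beacon

/-! ### Connected transversals of trees of four-element sets -/

namespace Beacon

variable {V : Type*} [DecidableEq V]

/-- The points of `B` meet every set in `C`, and are connected to each other through common
membership in sets of `C`. -/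
def IsConnectedTransversal (B : Finset V) (C : Finset (Finset V)) : Prop :=
  (∀ s ∈ C, ∃ b ∈ B, b ∈ s) ∧
    ∀ a ∈ B, ∀ b ∈ B,
      Relation.ReflTransGen (fun x y => y ∈ B ∧ ∃ s ∈ C, x ∈ s ∧ y ∈ s) a b

theorem IsConnectedTransversal.union {B₁ B₂ : Finset V} {C₁ C₂ : Finset (Finset V)}
    (h₁ : IsConnectedTransversal B₁ C₁) (h₂ : IsConnectedTransversal B₂ C₂) {x : V}
    (hx₁ : x ∈ B₁) (hx₂ : x ∈ B₂) : IsConnectedTransversal (B₁ ∪ B₂) (C₁ ∪ C₂) := by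
  have l₁ : ∀ a ∈ B₁, ∀ b ∈ B₁, Relation.ReflTransGen
      (fun x y => y ∈ B₁ ∪ B₂ ∧ ∃ s ∈ C₁ ∪ C₂, x ∈ s ∧ y ∈ s) a b := fun a ha b hb =>
    Relation.ReflTransGen.mono (fun x y ⟨hy, s, hs, h⟩ =>
      ⟨Finset.mem_union_left _ hy, s, Finset.mem_union_left _ hs, h⟩) _ _ (h₁.2 a ha b hb)
  have l₂ : ∀ a ∈ B₂, ∀ b ∈ B₂, Relation.ReflTransGen
      (fun x y => y ∈ B₁ ∪ B₂ ∧ ∃ s ∈ C₁ ∪ C₂, x ∈ s ∧ y ∈ s) a b := fun a ha b hb =>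
    Relation.ReflTransGen.mono (fun x y ⟨hy, s, hs, h⟩ =>
      ⟨Finset.mem_union_right _ hy, s, Finset.mem_union_right _ hs, h⟩) _ _ (h₂.2 a ha b hb)
  refine ⟨fun s hs => ?_, fun a ha b hb => ?_⟩
  · rcases Finset.mem_union.1 hs with hs | hs
    · obtain ⟨b, hb, h⟩ := h₁.1 s hs
      exact ⟨b, Finset.mem_union_left _ hb, h⟩
    · obtain ⟨b, hb, h⟩ := h₂.1 s hs
      exact ⟨b, Finset.mem_union_right _ hb, h⟩
  · refine Relation.ReflTransGen.trans (b := x) ?_ ?_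
    · rcases Finset.mem_union.1 ha with ha | ha
      · exact l₁ a ha x hx₁
      · exact l₂ a ha x hx₂
    · rcases Finset.mem_union.1 hb with hb | hb
      · exact l₁ x hx₁ b hb
      · exact l₂ x hx₂ b hb

omit [DecidableEq V] in
theorem isConnectedTransversal_singleton {S u : Finset V} (hS : S ⊆ u) (hne : S.Nonempty) :
    IsConnectedTransversal S {u} := by
  refine ⟨fun s hs => ?_, fun a ha b hb => .single ⟨hb, u, by simp, hS ha, hS hb⟩⟩
  obtain ⟨b, hb⟩ := hne
  rw [Finset.mem_singleton.1 hs]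
  exact ⟨b, hb, hS hb⟩

/-- `C` is the set of nodes of a tree with root `u`, the nodes being finite sets, with adjacent
nodes having three elements in common. -/
inductive IsFacetTree : Finset V → Finset (Finset V) → Prop
  | single (u : Finset V) : IsFacetTree u {u}
  | graft {u c : Finset V} {C D : Finset (Finset V)} : IsFacetTree u C → IsFacetTree c D →
      (u ∩ c).card = 3 → Disjoint C D → IsFacetTree u (C ∪ D)

theorem IsFacetTree.root_mem {u : Finset V} {C : Finset (Finset V)} (h : IsFacetTree u C) :
    u ∈ C := by
  induction h with
  | single u => simp
  | graft _ _ _ _ ih _ => exact Finset.mem_union_left _ ih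

/-- The constructor `graft` only glues at the root; this allows any node `v`, so that trees can be
grown and rerooted. -/
theorem IsFacetTree.attach {u v c : Finset V} {C D : Finset (Finset V)} (h : IsFacetTree u C)
    (hv : v ∈ C) (hD : IsFacetTree c D) (hvc : (v ∩ c).card = 3) (hCD : Disjoint C D) :
    IsFacetTree u (C ∪ D) := by
  induction h with
  | single u =>
    rw [Finset.mem_singleton] at hv
    subst hv
    exact .graft (.single v) hD hvc hCD
  | @graft u c' C₁ C₂ h₁ h₂ h₁₂ hd ih₁ ih₂ =>
    rw [Finset.disjoint_union_left] at hCD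
    rcases Finset.mem_union.1 hv with hv | hv
    · rw [Finset.union_right_comm]
      exact .graft (ih₁ hv hCD.1) h₂ h₁₂ (Finset.disjoint_union_left.2 ⟨hd, hCD.2.symm⟩)
    · rw [Finset.union_assoc]
      exact .graft h₁ (ih₂ hv hCD.2) h₁₂ (Finset.disjoint_union_right.2 ⟨hd, hCD.1⟩)

/-- Adjacency is symmetric: if `v` lies in the grafted subtree, that subtree is rerooted at `v` and
the rest is attached to its old root. Needed to make the neighbour of a leaf the root. -/
theorem IsFacetTree.reroot {u v : Finset V} {C : Finset (Finset V)} (h : IsFacetTree u C)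
    (hv : v ∈ C) : IsFacetTree v C := by
  induction h with
  | single u =>
    rw [Finset.mem_singleton] at hv
    subst hv
    exact .single v
  | graft h₁ h₂ h₁₂ hd ih₁ ih₂ =>
    rcases Finset.mem_union.1 hv with hv | hv
    · exact (ih₁ hv).attach h₁.root_mem h₂ h₁₂ hd
    · rw [Finset.union_comm]
      exact (ih₂ hv).attach h₂.root_mem h₁ (by rwa [Finset.inter_comm]) hd.symm

/-- A solution of a hitting problem in a set with a distinguished subset `f`: the sets in `L` with
their weights are hit by `S` and any single further point of `e`. -/
def HasCheapHitting (u f : Finset V) (L : Multiset (Finset V × ℕ)) : Prop :=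
  ∃ S ⊆ u, ∃ e ⊆ f, ∃ r, 1 ≤ r ∧ r ≤ 3 ∧ 4 ≤ e.card + r ∧
    3 * S.card + r ≤ (L.map Prod.snd).sum + 1 ∧
    ∀ x ∈ e, ∀ d ∈ L, ∃ y ∈ insert x S, y ∈ d.1

/-- A group of demands `K` whose total weight pays three per point of `Y` can be dropped from the
problem. -/
theorem HasCheapHitting.of_hit {u f : Finset V} {L K : Multiset (Finset V × ℕ)} {Y : Finset V}
    (h : HasCheapHitting u f L) (hYu : Y ⊆ u) (hK : ∀ d ∈ K, ∃ y ∈ Y, y ∈ d.1)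
    (hw : 3 * Y.card ≤ (K.map Prod.snd).sum) : HasCheapHitting u f (K + L) := by
  obtain ⟨S, hSu, e, hef, r, h1, h3, he, hS, hx⟩ := h
  refine ⟨Y ∪ S, Finset.union_subset hYu hSu, e, hef, r, h1, h3, he, ?_, fun x hxe d hd => ?_⟩
  · have := Finset.card_union_le Y S
    rw [Multiset.map_add, Multiset.sum_add]
    omega
  · rcases Multiset.mem_add.1 hd with hd | hd
    · obtain ⟨y, hy, hyd⟩ := hK d hd
      exact ⟨y, by simp [hy], hyd⟩
    · obtain ⟨y, hy, hyd⟩ := hx x hxe d hd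
      refine ⟨y, ?_, hyd⟩
      simp only [Finset.mem_insert, Finset.mem_union] at hy ⊢
      tauto

theorem card_add_card_le_four_add {u s t : Finset V} (hu : u.card = 4) (hs : s ⊆ u)
    (ht : t ⊆ u) : s.card + t.card ≤ 4 + (s ∩ t).card := by
  have h1 := Finset.card_union_add_card_inter s t
  have h2 := Finset.card_le_card (Finset.union_subset hs ht)
  omega

theorem exists_mem_of_four_lt {u s t : Finset V} (hu : u.card = 4) (hs : s ⊆ u)
    (ht : t ⊆ u) (h : 4 < s.card + t.card) : ∃ y ∈ s, y ∈ t := by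
  have := card_add_card_le_four_add hu hs ht
  obtain ⟨y, hy⟩ := Finset.card_pos.1 (show 0 < (s ∩ t).card by omega)
  exact ⟨y, Finset.mem_of_mem_inter_left hy, Finset.mem_of_mem_inter_right hy⟩

/-- Of three pairs in a set of four points, some two meet. -/
theorem exists_mem_two_of_three {u a b c : Finset V} (hu : u.card = 4) (ha : a ⊆ u) (hb : b ⊆ u)
    (hc : c ⊆ u) (ha2 : 2 ≤ a.card) (hb2 : 2 ≤ b.card) (hc2 : 2 ≤ c.card) :
    (∃ y ∈ a, y ∈ b) ∨ (∃ y ∈ a, y ∈ c) ∨ ∃ y ∈ b, y ∈ c := by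
  by_contra! h
  obtain ⟨hab, hac, hbc⟩ := h
  have h1 : Disjoint a b := Finset.disjoint_left.2 hab
  have h2 : Disjoint (a ∪ b) c :=
    Finset.disjoint_union_left.2 ⟨Finset.disjoint_left.2 hac, Finset.disjoint_left.2 hbc⟩
  have := Finset.card_le_card (Finset.union_subset (Finset.union_subset ha hb) hc)
  rw [Finset.card_union_of_disjoint h2, Finset.card_union_of_disjoint h1] at this
  omega

/-- A common point of two of the pairs leaves one point for the third. -/
theorem exists_pair_hitting_three {u a b c : Finset V} (hu : u.card = 4) (ha : a ⊆ u)
    (hb : b ⊆ u) (hc : c ⊆ u) (ha2 : 2 ≤ a.card) (hb2 : 2 ≤ b.card) (hc2 : 2 ≤ c.card) :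
    ∃ y ∈ u, ∃ z ∈ u, (y ∈ a ∨ z ∈ a) ∧ (y ∈ b ∨ z ∈ b) ∧ (y ∈ c ∨ z ∈ c) := by
  obtain ⟨pa, hpa⟩ := Finset.card_pos.1 (show 0 < a.card by omega)
  obtain ⟨pb, hpb⟩ := Finset.card_pos.1 (show 0 < b.card by omega)
  obtain ⟨pc, hpc⟩ := Finset.card_pos.1 (show 0 < c.card by omega)
  rcases exists_mem_two_of_three hu ha hb hc ha2 hb2 hc2 with ⟨y, h, h'⟩ | ⟨y, h, h'⟩ | ⟨y, h, h'⟩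
  · exact ⟨y, ha h, pc, hc hpc, by tauto⟩
  · exact ⟨y, ha h, pb, hb hpb, by tauto⟩
  · exact ⟨y, hb h, pa, ha hpa, by tauto⟩

/-- Two pairs in a set of four points, one of them in the distinguished triple or both
containing the point outside of it. -/
theorem hasCheapHitting_two_pairs {u f a b : Finset V} {i j : ℕ} (hu : u.card = 4)
    (hf : f ⊆ u) (hf3 : f.card = 3) (ha : a ⊆ u) (hb : b ⊆ u) (ha2 : 2 ≤ a.card)
    (hb2 : 2 ≤ b.card) (hi : i = 2) (hj : j = 2) : HasCheapHitting u f {(a, i), (b, j)} := by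
  subst hi hj
  by_cases hbf : b ⊆ f
  · obtain ⟨y, hy⟩ := Finset.card_pos.1 (show 0 < a.card by omega)
    refine ⟨{y}, by simpa using ha hy, b, hbf, 2, by omega, by omega, by omega, by simp, ?_⟩
    intro x hx d hd
    simp only [Multiset.insert_eq_cons, Multiset.mem_cons, Multiset.mem_singleton] at hd
    rcases hd with rfl | rfl
    · exact ⟨y, by simp, hy⟩
    · exact ⟨x, by simp, hx⟩
  by_cases haf : a ⊆ f
  · obtain ⟨y, hy⟩ := Finset.card_pos.1 (show 0 < b.card by omega)
    refine ⟨{y}, by simpa using hb hy, a, haf, 2, by omega, by omega, by omega, by simp, ?_⟩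
    intro x hx d hd
    simp only [Multiset.insert_eq_cons, Multiset.mem_cons, Multiset.mem_singleton] at hd
    rcases hd with rfl | rfl
    · exact ⟨x, by simp, hx⟩
    · exact ⟨y, by simp, hy⟩
  obtain ⟨y, hya, hyf⟩ := Finset.not_subset.1 haf
  obtain ⟨z, hzb, hzf⟩ := Finset.not_subset.1 hbf
  -- Both pairs now contain the only point outside `f`. Choosing it settles both, and all of `f`
  -- stays available.
  have hc : (u \ f).card = 1 := by rw [Finset.card_sdiff_of_subset hf]; omega
  obtain ⟨g, hg⟩ := Finset.card_eq_one.1 hc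
  have hyg : y = g := by
    rw [← Finset.mem_singleton, ← hg]; exact Finset.mem_sdiff.2 ⟨ha hya, hyf⟩
  have hzg : z = g := by
    rw [← Finset.mem_singleton, ← hg]; exact Finset.mem_sdiff.2 ⟨hb hzb, hzf⟩
  subst hyg hzg
  refine ⟨{z}, by simpa using hb hzb, f, subset_rfl, 2, by omega, by omega, by omega, by simp, ?_⟩
  intro x hx d hd
  simp only [Multiset.insert_eq_cons, Multiset.mem_cons, Multiset.mem_singleton] at hd
  rcases hd with rfl | rfl
  · exact ⟨z, by simp, hya⟩
  · exact ⟨z, by simp, hzb⟩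

/-- No point is bought here: the free point hits everything, and the whole budget may be passed on,
so `r = 4 - e.card`. -/
theorem hasCheapHitting_of_forall_mem {u f e : Finset V} {L : Multiset (Finset V × ℕ)}
    (hef : e ⊆ f) (hf : f.card = 3) (he : e.Nonempty) (hL : ∀ x ∈ e, ∀ d ∈ L, x ∈ d.1)
    (hw : 3 ≤ e.card + (L.map Prod.snd).sum) : HasCheapHitting u f L := by
  have := Finset.card_le_card hef
  have := he.card_pos
  exact ⟨∅, by simp, e, hef, 4 - e.card, by omega, by omega, by omega, by simp; omega,
    fun x hx d hd => ⟨x, by simp, hL x hx d hd⟩⟩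

/-- Four kinds of groups pay for themselves: one demand of weight 3; a weight 1 with a weight 2 (a
triple meets a pair); three of weight 1 (three triples have a common point); three of weight 2 (two
points suffice). Once these are removed, at most two demands remain, all of the same weight 1 or 2.
They are settled within `f` alone, except that two pairs need one bought point. -/
theorem hasCheapHitting {u f : Finset V} (hu : u.card = 4) (hf : f ⊆ u) (hf3 : f.card = 3)
    (L : Multiset (Finset V × ℕ))
    (hL : ∀ d ∈ L, d.1 ⊆ u ∧ 1 ≤ d.2 ∧ d.2 ≤ 3 ∧ 4 ≤ d.1.card + d.2) :
    HasCheapHitting u f L := by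
  induction hn : L.card using Nat.strong_induction_on generalizing L with
  | _ n ih =>
    have step : ∀ K M : Multiset (Finset V × ℕ), L = K + M → K ≠ 0 →
        (∃ Y ⊆ u, (∀ d ∈ K, ∃ y ∈ Y, y ∈ d.1) ∧ 3 * Y.card ≤ (K.map Prod.snd).sum) →
        HasCheapHitting u f L := by
      rintro K M rfl hK ⟨Y, hYu, hY, hw⟩
      have hKc : 0 < K.card := Multiset.card_pos.2 hK
      exact (ih M.card (by rw [← hn, Multiset.card_add]; omega) M
        (fun d hd => hL d (Multiset.mem_add.2 (.inr hd))) rfl).of_hit hYu hY hw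
    by_cases h3 : ∃ d ∈ L, d.2 = 3
    · obtain ⟨d, hd, hd3⟩ := h3
      obtain ⟨M, rfl⟩ := Multiset.exists_cons_of_mem hd
      obtain ⟨hdu, -, -, hdc⟩ := hL d hd
      obtain ⟨y, hy⟩ := Finset.card_pos.1 (show 0 < d.1.card by omega)
      refine step {d} M (by simp) (by simp) ⟨{y}, by simpa using hdu hy, ?_, by simp [hd3]⟩
      simpa using hy
    push Not at h3
    obtain ⟨M₁, M₂, rfl, hM₁, hM₂⟩ : ∃ M₁ M₂ : Multiset (Finset V × ℕ), L = M₁ + M₂ ∧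
        (∀ d ∈ M₁, d.2 = 1) ∧ ∀ d ∈ M₂, d.2 = 2 := by
      refine ⟨L.filter (fun d => d.2 = 1), L.filter (fun d => ¬ d.2 = 1),
        (Multiset.filter_add_not _ _).symm, by simp, fun d hd => ?_⟩
      obtain ⟨hd, hd1⟩ := Multiset.mem_filter.1 hd
      have := hL d hd
      have := h3 d hd
      omega
    have hL₁ : ∀ d ∈ M₁, d.1 ⊆ u ∧ 3 ≤ d.1.card := fun d hd => by
      have h := hL d (Multiset.mem_add.2 (.inl hd))
      have := hM₁ d hd
      exact ⟨h.1, by omega⟩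
    have hL₂ : ∀ d ∈ M₂, d.1 ⊆ u ∧ 2 ≤ d.1.card := fun d hd => by
      have h := hL d (Multiset.mem_add.2 (.inr hd))
      have := hM₂ d hd
      exact ⟨h.1, by omega⟩
    rcases Multiset.empty_or_exists_mem M₁ with rfl | ⟨a, ha⟩
    · rcases Multiset.empty_or_exists_mem M₂ with rfl | ⟨a, ha⟩
      · exact hasCheapHitting_of_forall_mem subset_rfl hf3 (Finset.card_pos.1 (by omega))
          (by simp) (by omega)
      obtain ⟨N, rfl⟩ := Multiset.exists_cons_of_mem ha
      obtain ⟨hau, hac⟩ := hL₂ a ha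
      have ha2 := hM₂ a ha
      rcases Multiset.empty_or_exists_mem N with rfl | ⟨b, hb⟩
      · have := card_add_card_le_four_add hu hau hf
        refine hasCheapHitting_of_forall_mem (e := a.1 ∩ f) Finset.inter_subset_right hf3
          (Finset.card_pos.1 (by omega)) ?_ (by simp; omega)
        simp +contextual
      obtain ⟨N', rfl⟩ := Multiset.exists_cons_of_mem hb
      obtain ⟨hbu, hbc⟩ := hL₂ b (Multiset.mem_cons_of_mem hb)
      have hb2 := hM₂ b (Multiset.mem_cons_of_mem hb)
      rcases Multiset.empty_or_exists_mem N' with rfl | ⟨c, hc⟩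
      · exact hasCheapHitting_two_pairs (i := a.2) (j := b.2) hu hf hf3 hau hbu hac hbc ha2 hb2
      obtain ⟨N, rfl⟩ := Multiset.exists_cons_of_mem hc
      have hc' : c ∈ a ::ₘ b ::ₘ c ::ₘ N := by simp
      obtain ⟨hcu, hcc⟩ := hL₂ c hc'
      have hc2 := hM₂ c hc'
      obtain ⟨y, hy, z, hz, h⟩ := exists_pair_hitting_three hu hau hbu hcu hac hbc hcc
      refine step {a, b, c} N (by simp [Multiset.insert_eq_cons]) (by simp)
        ⟨{y, z}, by simp [Finset.insert_subset_iff, hy, hz], ?_, ?_⟩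
      · simpa [Multiset.insert_eq_cons] using h
      · have := Finset.card_le_two (a := y) (b := z)
        simp [Multiset.insert_eq_cons]
        omega
    obtain ⟨N, rfl⟩ := Multiset.exists_cons_of_mem ha
    obtain ⟨hau, hac⟩ := hL₁ a ha
    have ha1 := hM₁ a ha
    rcases Multiset.empty_or_exists_mem M₂ with rfl | ⟨b, hb⟩
    · rcases Multiset.empty_or_exists_mem N with rfl | ⟨b, hb⟩
      · have := card_add_card_le_four_add hu hau hf
        refine hasCheapHitting_of_forall_mem (e := a.1 ∩ f) Finset.inter_subset_right hf3
          (Finset.card_pos.1 (by omega)) ?_ (by simp; omega)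
        simp +contextual
      obtain ⟨N', rfl⟩ := Multiset.exists_cons_of_mem hb
      obtain ⟨hbu, hbc⟩ := hL₁ b (Multiset.mem_cons_of_mem hb)
      have hb1 := hM₁ b (Multiset.mem_cons_of_mem hb)
      have hab := card_add_card_le_four_add hu hau hbu
      rcases Multiset.empty_or_exists_mem N' with rfl | ⟨c, hc⟩
      · have := card_add_card_le_four_add hu (Finset.inter_subset_left.trans hau : a.1 ∩ b.1 ⊆ u) hf
        refine hasCheapHitting_of_forall_mem (e := a.1 ∩ b.1 ∩ f) Finset.inter_subset_right hf3
          (Finset.card_pos.1 (by omega)) ?_ (by simp [-Finset.inter_assoc]; omega)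
        simp +contextual
      obtain ⟨N, rfl⟩ := Multiset.exists_cons_of_mem hc
      have hc' : c ∈ a ::ₘ b ::ₘ c ::ₘ N := by simp
      obtain ⟨hcu, hcc⟩ := hL₁ c hc'
      have hc1 := hM₁ c hc'
      obtain ⟨y, hy, hyc⟩ := exists_mem_of_four_lt hu
        (Finset.inter_subset_left.trans hau : a.1 ∩ b.1 ⊆ u) hcu (by omega)
      rw [Finset.mem_inter] at hy
      refine step {a, b, c} N (by simp [Multiset.insert_eq_cons]) (by simp)
        ⟨{y}, by simpa using hcu hyc, ?_, ?_⟩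
      · simpa [Multiset.insert_eq_cons, and_assoc] using And.intro hy hyc
      · simp [Multiset.insert_eq_cons]
        omega
    · obtain ⟨N', rfl⟩ := Multiset.exists_cons_of_mem hb
      obtain ⟨hbu, hbc⟩ := hL₂ b hb
      have hb2 := hM₂ b hb
      obtain ⟨y, hy, hyb⟩ := exists_mem_of_four_lt hu hau hbu (by omega)
      refine step {a, b} (N + N') (by
        simp [Multiset.insert_eq_cons, Multiset.cons_swap]) (by simp) ⟨{y}, by simpa using hau hy, ?_, ?_⟩
      · simpa [Multiset.insert_eq_cons] using And.intro hy hyb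
      · simp [Multiset.insert_eq_cons]
        omega

/-- A transversal of a tree of sets of four elements: apart from one element that may be chosen in
a large part of a given triple in the root, it has at most a third as many elements as
the tree has nodes. -/
theorem IsFacetTree.exists_transversal {u : Finset V} {C : Finset (Finset V)}
    (h : IsFacetTree u C) (hC : ∀ s ∈ C, s.card = 4) {f : Finset V} (hf : f ⊆ u)
    (hf3 : f.card = 3) :
    ∃ B : Finset V, ∃ e ⊆ f, ∃ r, 1 ≤ r ∧ r ≤ 3 ∧ 4 ≤ e.card + r ∧ 3 * B.card + r ≤ C.card ∧
      B ⊆ C.sup id ∧ ∀ x ∈ e, IsConnectedTransversal (insert x B) C := by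
  -- Here `L` collects the demands of the children grafted so far, left open because the root may
  -- receive more children. The `+ 1` is the root's own contribution to the budget.
  have key : ∃ (B : Finset V) (L : Multiset (Finset V × ℕ)),
      (∀ d ∈ L, d.1 ⊆ u ∧ 1 ≤ d.2 ∧ d.2 ≤ 3 ∧ 4 ≤ d.1.card + d.2) ∧
      3 * B.card + (L.map Prod.snd).sum + 1 ≤ C.card ∧ B ⊆ C.sup id ∧
      ∀ S ⊆ u, S.Nonempty → (∀ d ∈ L, ∃ y ∈ S, y ∈ d.1) → IsConnectedTransversal (B ∪ S) C := by
    clear hf hf3 f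
    induction h with
    | single u =>
      refine ⟨∅, 0, by simp, by simp, by simp, fun S hS hne _ => ?_⟩
      rw [Finset.empty_union]
      exact isConnectedTransversal_singleton hS hne
    | @graft u c C D h₁ h₂ huc hd ih₁ ih₂ =>
      obtain ⟨B₁, L₁, hL₁, hc₁, hBC₁, hB₁⟩ := ih₁ fun s hs => hC s (Finset.mem_union_left _ hs)
      obtain ⟨B₂, L₂, hL₂, hc₂, hBC₂, hB₂⟩ := ih₂ fun s hs => hC s (Finset.mem_union_right _ hs)
      -- Once `c` gets its parent `u`, its demands are settled with `u ∩ c` as the distinguished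
      -- triple; what is left is the single demand `(e, r)` on `u`.
      obtain ⟨S, hSc, e, hef, r, h1, h3, he, hS, hx⟩ :=
        hasCheapHitting (hC c (Finset.mem_union_right _ h₂.root_mem))
          (Finset.inter_subset_right : u ∩ c ⊆ c) huc L₂ hL₂
      refine ⟨B₁ ∪ (B₂ ∪ S), (e, r) ::ₘ L₁, ?_, ?_, ?_, fun T hT hne hTL => ?_⟩
      · intro d hd
        rcases Multiset.mem_cons.1 hd with rfl | hd
        · exact ⟨hef.trans Finset.inter_subset_left, h1, h3, he⟩
        · exact hL₁ d hd
      · have i₁ := Finset.card_union_le B₁ (B₂ ∪ S)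
        have i₂ := Finset.card_union_le B₂ S
        rw [Finset.card_union_of_disjoint hd, Multiset.map_cons, Multiset.sum_cons]
        omega
      · rw [Finset.sup_union]
        exact Finset.union_subset_union hBC₁
          (Finset.union_subset hBC₂ (hSc.trans (Finset.le_sup (f := id) h₂.root_mem)))
      · obtain ⟨y, hyT, hye⟩ := hTL (e, r) (Multiset.mem_cons_self _ _)
        have g₁ := hB₁ T hT hne fun d hd => hTL d (Multiset.mem_cons_of_mem hd)
        have g₂ := hB₂ (insert y S)
          (Finset.insert_subset (Finset.mem_of_mem_inter_right (hef hye)) hSc)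
          (Finset.insert_nonempty _ _) (hx y hye)
        have := g₁.union g₂ (x := y) (by simp [hyT]) (by simp)
        convert this using 1
        ext z
        simp only [Finset.mem_union, Finset.mem_insert]
        constructor
        · tauto
        · rintro ((h | h) | h | rfl | h) <;> tauto
  obtain ⟨B, L, hL, hcard, hBC, hB⟩ := key
  obtain ⟨S, hSu, e, hef, r, h1, h3, he, hS, hx⟩ :=
    hasCheapHitting (hC u h.root_mem) hf hf3 L hL
  refine ⟨B ∪ S, e, hef, r, h1, h3, he, ?_, ?_, fun x hxe => ?_⟩
  · have := Finset.card_union_le B S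
    omega
  · exact Finset.union_subset hBC (hSu.trans (Finset.le_sup (f := id) h.root_mem))
  · rw [← Finset.union_insert]
    exact hB _ (Finset.insert_subset (hf (hef hxe)) hSu) (Finset.insert_nonempty _ _)
      fun d hd => hx x hxe d hd

end Beacon

/-! ### Regular closed sets meeting in finitely many lines -/

namespace Beacon

open Metric Set

theorem affineSpan_ne_top_of_card_le {e : Finset Space3} (he : e.card ≤ 3) :
    affineSpan ℝ (e : Set Space3) ≠ ⊤ := by
  classical
  rcases e.eq_empty_or_nonempty with rfl | hne
  · simp
  intro h
  rw [AffineSubspace.affineSpan_eq_top_iff_vectorSpan_eq_top_of_nonempty ℝ Space3 Space3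
    (by simpa using hne)] at h
  have hc := hne.card_pos
  have := finrank_vectorSpan_image_finset_le ℝ (id : Space3 → Space3) e
    (n := e.card - 1) (by omega)
  rw [Finset.image_id, h, finrank_top, finrank_euclideanSpace_fin] at this
  omega

theorem dense_compl_biUnion_affineSubspace {ι : Type*} (s : Finset ι)
    (H : ι → AffineSubspace ℝ Space3) (hH : ∀ i ∈ s, H i ≠ ⊤) :
    Dense (⋃ i ∈ s, (H i : Set Space3))ᶜ := by
  refine MeasureTheory.Measure.dense_of_ae (μ := MeasureTheory.volume) ?_
  rw [MeasureTheory.ae_iff]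
  simp only [not_not, ofPred_mem_eq]
  exact (MeasureTheory.measure_biUnion_null_iff s.countable_toSet).2 fun i hi =>
    MeasureTheory.Measure.addHaar_affineSubspace _ _ (hH i hi)

theorem dense_compl_affineSubspace {H : AffineSubspace ℝ Space3} (hH : H ≠ ⊤) :
    Dense (H : Set Space3)ᶜ := by
  simpa using dense_compl_biUnion_affineSubspace {H} id (by simpa using hH)

theorem mem_of_lineMap_mem {H : AffineSubspace ℝ Space3} {z o : Space3} {τ : ℝ} (hτ : τ ≠ 1)
    (ho : o ∈ H) (h : AffineMap.lineMap z o τ ∈ H) : z ∈ H := by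
  have hτ' : 1 - τ ≠ 0 := sub_ne_zero.2 hτ.symm
  have := AffineMap.lineMap_mem (1 - τ)⁻¹ ho h
  convert this using 1
  simp only [AffineMap.lineMap_apply, vsub_eq_sub, vadd_eq_add]
  have e : τ • (o - z) + z - o = (1 - τ) • (z - o) := by module
  rw [e, smul_smul, inv_mul_cancel₀ hτ', one_smul, sub_add_cancel]

/-- Removing finitely many lines does not disconnect a convex open set. -/
theorem isPreconnected_diff_lines {U : Set Space3} (hU : IsOpen U) (hc : Convex ℝ U)
    (𝓔 : Finset (Finset Space3)) (h𝓔 : ∀ e ∈ 𝓔, e.card ≤ 2) :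
    IsPreconnected (U \ ⋃ e ∈ 𝓔, (affineSpan ℝ (e : Set Space3) : Set Space3)) := by
  classical
  refine isPreconnected_of_forall_pair fun x hx y hy => ?_
  have hcard : ∀ w : Space3, ∀ e ∈ 𝓔,
      affineSpan ℝ ((insert w e : Finset Space3) : Set Space3) ≠ ⊤ := fun w e he =>
    affineSpan_ne_top_of_card_le ((Finset.card_insert_le _ _).trans (by have := h𝓔 e he; omega))
  -- A generic `o` avoids the flats spanned by `x` or `y` with each line, so the segments from `o`
  -- to `x` and to `y` miss all lines.
  have hd := dense_compl_biUnion_affineSubspace (({x, y} : Finset Space3) ×ˢ 𝓔)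
    (fun p => affineSpan ℝ ((insert p.1 p.2 : Finset Space3) : Set Space3)) (by
      rintro ⟨w, e⟩ hwe
      exact hcard w e (Finset.mem_product.1 hwe).2)
  obtain ⟨o, hoU, ho⟩ := hd.inter_open_nonempty U hU ⟨x, hx.1⟩
  have key : ∀ w ∈ U \ ⋃ e ∈ 𝓔, (affineSpan ℝ (e : Set Space3) : Set Space3), w = x ∨ w = y →
      segment ℝ o w ⊆ U \ ⋃ e ∈ 𝓔, (affineSpan ℝ (e : Set Space3) : Set Space3) := by
    intro w hw hwxy z hz
    refine ⟨hc.segment_subset hoU hw.1 hz, fun hzE => ?_⟩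
    simp only [mem_iUnion, SetLike.mem_coe, exists_prop] at hzE
    obtain ⟨e, he, hze⟩ := hzE
    rw [segment_eq_image_lineMap] at hz
    obtain ⟨τ, -, rfl⟩ := hz
    rcases eq_or_ne τ 1 with rfl | hτ
    · rw [AffineMap.lineMap_apply_one] at hze
      exact hw.2 (by simp only [mem_iUnion]; exact ⟨e, he, hze⟩)
    · refine ho ?_
      simp only [mem_iUnion]
      refine ⟨(w, e), ?_, ?_⟩
      · simpa using ⟨hwxy, he⟩
      · refine mem_of_lineMap_mem hτ (subset_affineSpan ℝ _ (?_ : w ∈ _))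
          (affineSpan_mono ℝ ?_ hze)
        · simp
        · simp
  refine ⟨segment ℝ o x ∪ segment ℝ o y, union_subset (key x hx (.inl rfl)) (key y hy (.inr rfl)),
    .inl (right_mem_segment ℝ _ _), .inr (right_mem_segment ℝ _ _), ?_⟩
  exact IsPreconnected.union o (left_mem_segment ℝ _ _) (left_mem_segment ℝ _ _)
    (convex_segment o x).isPreconnected (convex_segment o y).isPreconnected

theorem IsPreconnected.subset_interior_or_subset_compl {s a : Set Space3} (hs : IsPreconnected s)
    (ha : IsClosed a) (h : Disjoint s (frontier a)) : s ⊆ interior a ∨ s ⊆ aᶜ := by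
  refine hs.subset_or_subset isOpen_interior ha.isOpen_compl
    (disjoint_compl_right.mono_left interior_subset) fun z hz => ?_
  by_contra hn
  rw [mem_union, not_or, notMem_compl_iff] at hn
  exact disjoint_left.1 h hz (by rw [ha.frontier_eq]; exact ⟨hn.2, hn.1⟩)

/-- The frontier of a regular closed set is nowhere contained in a thin set that does not
separate space locally. -/
theorem not_isPreconnected_diff {a U N : Set Space3} (ha : IsClosed a)
    (hr : a ⊆ closure (interior a)) (hU : IsOpen U) {y : Space3} (hyU : y ∈ U)
    (hy : y ∈ frontier a) (hN : Dense Nᶜ) (hfr : frontier a ∩ U ⊆ N) :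
    ¬ IsPreconnected (U \ N) := by
  intro hpre
  rw [ha.frontier_eq] at hy
  -- Near `y` there are open sets of points inside `a` (by regularity) and outside `a`. Neither
  -- disappears when the thin set `N` is removed.
  rcases IsPreconnected.subset_interior_or_subset_compl hpre ha
    (disjoint_left.2 fun z hz hza => hz.2 (hfr ⟨hza, hz.1⟩)) with h | h
  · have hne : (U ∩ aᶜ).Nonempty := by
      by_contra hemp
      refine hy.2 (mem_interior.2 ⟨U, fun z hz => ?_, hU, hyU⟩)
      by_contra hza
      exact hemp ⟨z, hz, hza⟩
    obtain ⟨o, ⟨hoU, hoa⟩, hoN⟩ := hN.inter_open_nonempty _ (hU.inter ha.isOpen_compl) hne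
    exact hoa (interior_subset (h ⟨hoU, hoN⟩))
  · have hne : (U ∩ interior a).Nonempty := mem_closure_iff.1 (hr hy.1) U hU hyU
    obtain ⟨o, ⟨hoU, hoa⟩, hoN⟩ := hN.inter_open_nonempty _ (hU.inter isOpen_interior) hne
    exact h ⟨hoU, hoN⟩ (interior_subset hoa)

/-- Two regular closed sets whose intersection is contained in finitely many lines. -/
structure IsThinPair (a b : Set Space3) (𝓔 : Finset (Finset Space3)) : Prop where
  closed_left : IsClosed a
  closed_right : IsClosed b
  regular_left : a ⊆ closure (interior a)
  regular_right : b ⊆ closure (interior b)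
  card_le : ∀ e ∈ 𝓔, e.card ≤ 2
  inter_subset : a ∩ b ⊆ ⋃ e ∈ 𝓔, (affineSpan ℝ (e : Set Space3) : Set Space3)

namespace IsThinPair

variable {a b : Set Space3} {𝓔 : Finset (Finset Space3)}

theorem symm (h : IsThinPair a b 𝓔) : IsThinPair b a 𝓔 :=
  ⟨h.2, h.1, h.4, h.3, h.5, by rw [inter_comm]; exact h.6⟩

theorem dense_compl (h : IsThinPair a b 𝓔) :
    Dense (⋃ e ∈ 𝓔, (affineSpan ℝ (e : Set Space3) : Set Space3))ᶜ :=
  dense_compl_biUnion_affineSubspace 𝓔 (fun e => affineSpan ℝ (e : Set Space3)) fun e he =>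
    affineSpan_ne_top_of_card_le ((h.card_le e he).trans (by norm_num))

/-- Otherwise, by regularity of `b`, the interiors would meet in a nonempty open set contained in
lines. -/
theorem mem_frontier_left (h : IsThinPair a b 𝓔) {x : Space3} (hx : x ∈ a ∩ b) :
    x ∈ frontier a := by
  rw [h.closed_left.frontier_eq]
  refine ⟨hx.1, fun hi => ?_⟩
  have hne := mem_closure_iff.1 (h.regular_right hx.2) _ isOpen_interior hi
  obtain ⟨o, ⟨ho₁, ho₂⟩, ho⟩ := h.dense_compl.inter_open_nonempty _
    (isOpen_interior.inter isOpen_interior) hne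
  exact ho (h.inter_subset ⟨interior_subset ho₁, interior_subset ho₂⟩)

theorem frontier_left_inter_interior (h : IsThinPair a b 𝓔) :
    frontier a ∩ interior (a ∪ b) ⊆ a ∩ b := by
  rintro y ⟨hy, hyi⟩
  rw [h.closed_left.frontier_eq] at hy
  refine ⟨hy.1, ?_⟩
  by_contra hyb
  refine hy.2 (mem_interior.2 ⟨interior (a ∪ b) ∩ bᶜ, ?_,
    isOpen_interior.inter h.closed_right.isOpen_compl, hyi, hyb⟩)
  rintro z ⟨hz, hzb⟩
  exact (interior_subset hz).resolve_right hzb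

/-- In a ball inside `a ∪ b` the frontier of `a` lies in `a ∩ b`, hence in lines, which cannot
separate `a` from its complement. -/
theorem inter_subset_frontier_union (h : IsThinPair a b 𝓔) : a ∩ b ⊆ frontier (a ∪ b) := by
  intro x hx
  rw [(h.closed_left.union h.closed_right).frontier_eq]
  refine ⟨.inl hx.1, fun hi => ?_⟩
  obtain ⟨ε, hε, hball⟩ := Metric.isOpen_iff.1 isOpen_interior x hi
  refine not_isPreconnected_diff h.closed_left h.regular_left isOpen_ball (mem_ball_self hε)
    (h.mem_frontier_left hx) h.dense_compl ?_
    (isPreconnected_diff_lines isOpen_ball (convex_ball x ε) 𝓔 h.card_le)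
  exact fun z hz => h.inter_subset (h.frontier_left_inter_interior ⟨hz.1, hball hz.2⟩)

theorem frontier_left_subset (h : IsThinPair a b 𝓔) : frontier a ⊆ frontier (a ∪ b) := by
  intro y hy
  by_contra hn
  have hya : y ∈ a := h.closed_left.frontier_subset hy
  have hi : y ∈ interior (a ∪ b) := by
    by_contra hni
    exact hn (by
      rw [(h.closed_left.union h.closed_right).frontier_eq]
      exact ⟨.inl hya, hni⟩)
  exact hn (h.inter_subset_frontier_union (h.frontier_left_inter_interior ⟨hy, hi⟩))

theorem frontier_right_subset (h : IsThinPair a b 𝓔) : frontier b ⊆ frontier (a ∪ b) := by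
  rw [union_comm]
  exact h.symm.frontier_left_subset

/-- Two regular closed sets do not meet where the frontier of their union is contained in a
plane. -/
theorem notMem_inter_of_frontier_subset_plane (h : IsThinPair a b 𝓔) {x : Space3} {ε : ℝ}
    (hε : 0 < ε) {H : AffineSubspace ℝ Space3} (hH : H ≠ ⊤) (hxH : x ∈ H)
    (hfr : frontier (a ∪ b) ∩ ball x ε ⊆ H) : x ∉ a ∩ b := by
  intro hx
  have hdir : H.direction < ⊤ := by
    rw [lt_top_iff_ne_top]
    rwa [Ne, AffineSubspace.direction_eq_top_iff_of_nonempty ⟨x, hxH⟩]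
  obtain ⟨f, hf0, hf⟩ := Submodule.exists_le_ker_of_lt_top _ hdir
  have hfH : ∀ z ∈ H, f z = f x := fun z hz => by
    have := hf (AffineSubspace.vsub_mem_direction hz hxH)
    rw [LinearMap.mem_ker, vsub_eq_sub, map_sub, sub_eq_zero] at this
    exact this
  have hlevel : Dense {z | f z = f x}ᶜ := by
    have hK : AffineSubspace.mk' x f.ker ≠ ⊤ := by
      intro htop
      have : (AffineSubspace.mk' x f.ker).direction = ⊤ := by
        rw [htop, AffineSubspace.direction_top]
      rw [AffineSubspace.direction_mk', LinearMap.ker_eq_top] at this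
      exact hf0 this
    convert dense_compl_affineSubspace hK using 2
    ext z
    simp [AffineSubspace.mem_mk', sub_eq_zero]
  set h₁ := ball x ε ∩ {z | f x < f z} with hh₁
  set h₂ := ball x ε ∩ {z | f z < f x} with hh₂
  have hcov : ∀ z ∈ ball x ε, z ∉ {z | f z = f x} → z ∈ h₁ ∪ h₂ := by
    intro z hz hne
    rcases lt_or_gt_of_ne hne with hlt | hlt
    · exact .inr ⟨hz, hlt⟩
    · exact .inl ⟨hz, hlt⟩
  have hc₁ : Convex ℝ h₁ := (convex_ball x ε).inter (convex_halfSpace_gt f.isLinear _)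
  have hc₂ : Convex ℝ h₂ := (convex_ball x ε).inter (convex_halfSpace_lt f.isLinear _)
  have hd₁ : Disjoint h₁ (frontier (a ∪ b)) := disjoint_left.2 fun z hz hzM =>
    (ne_of_gt hz.2) (hfH z (hfr ⟨hzM, hz.1⟩))
  have hd₂ : Disjoint h₂ (frontier (a ∪ b)) := disjoint_left.2 fun z hz hzM =>
    (ne_of_lt hz.2) (hfH z (hfr ⟨hzM, hz.1⟩))
  -- The open half-balls miss the frontier of `c`, so `c` contains any half-ball that its interior
  -- meets, and it meets at least one.
  have side : ∀ {c : Set Space3}, IsClosed c → c ⊆ closure (interior c) → x ∈ c →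
      frontier c ⊆ frontier (a ∪ b) → (h₁.Nonempty ∧ h₁ ⊆ c) ∨ (h₂.Nonempty ∧ h₂ ⊆ c) := by
    intro c hc hreg hxc hfc
    have hne := mem_closure_iff.1 (hreg hxc) _ isOpen_ball (mem_ball_self hε)
    obtain ⟨o, ⟨hoU, hoc⟩, ho⟩ := hlevel.inter_open_nonempty _
      (isOpen_ball.inter isOpen_interior) hne
    rcases hcov o hoU ho with ho' | ho'
    · refine .inl ⟨⟨o, ho'⟩, ?_⟩
      rcases IsPreconnected.subset_interior_or_subset_compl hc₁.isPreconnected hc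
        (hd₁.mono_right hfc) with h' | h'
      · exact h'.trans interior_subset
      · exact absurd (interior_subset hoc) (h' ho')
    · refine .inr ⟨⟨o, ho'⟩, ?_⟩
      rcases IsPreconnected.subset_interior_or_subset_compl hc₂.isPreconnected hc
        (hd₂.mono_right hfc) with h' | h'
      · exact h'.trans interior_subset
      · exact absurd (interior_subset hoc) (h' ho')
  have hnot₁ : h₁.Nonempty → ¬ (h₁ ⊆ a ∧ h₁ ⊆ b) := fun ⟨o, ho⟩ ⟨ha, hb⟩ =>
    disjoint_left.1 hd₁ ho (h.inter_subset_frontier_union ⟨ha ho, hb ho⟩)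
  have hnot₂ : h₂.Nonempty → ¬ (h₂ ⊆ a ∧ h₂ ⊆ b) := fun ⟨o, ho⟩ ⟨ha, hb⟩ =>
    disjoint_left.1 hd₂ ho (h.inter_subset_frontier_union ⟨ha ho, hb ho⟩)
  -- The two sets fill different halves, so `x` becomes an interior point of `a ∪ b`, contradicting
  -- `inter_subset_frontier_union`.
  have hsub : h₁ ∪ h₂ ⊆ a ∪ b := by
    rcases side h.closed_left h.regular_left hx.1 h.frontier_left_subset with ⟨n, s⟩ | ⟨n, s⟩ <;>
    rcases side h.closed_right h.regular_right hx.2 h.frontier_right_subset with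
      ⟨n', s'⟩ | ⟨n', s'⟩
    · exact absurd ⟨s, s'⟩ (hnot₁ n)
    · exact union_subset_union s s'
    · rw [union_comm]; exact union_subset_union s s'
    · exact absurd ⟨s, s'⟩ (hnot₂ n)
  have hxM := h.inter_subset_frontier_union hx
  rw [(h.closed_left.union h.closed_right).frontier_eq] at hxM
  refine hxM.2 (mem_interior.2 ⟨ball x ε, fun z hz => ?_, isOpen_ball, mem_ball_self hε⟩)
  by_contra hzP
  obtain ⟨o, ⟨hoU, hoP⟩, ho⟩ := hlevel.inter_open_nonempty _
    (isOpen_ball.inter (h.closed_left.union h.closed_right).isOpen_compl) ⟨z, hz, hzP⟩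
  exact hoP (hsub (hcov o hoU ho))

end IsThinPair

end Beacon

/-! ### Triangles of the boundary surface -/

namespace Beacon

open Metric Set

/-- Barycentric coordinates of a simplex extend to the whole space. -/
theorem exists_barycentricCoord {t : Finset Space3}
    (ht : AffineIndependent ℝ ((↑) : t → Space3)) {v : Space3} (hv : v ∈ t) :
    ∃ β : Space3 →ᵃ[ℝ] ℝ, β v = 1 ∧ ∀ w ∈ t, w ≠ v → β w = 0 := by
  obtain ⟨T, htT, hT, hspan⟩ :=
    exists_subset_affineIndependent_affineSpan_eq_top (s := (t : Set Space3)) ht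
  let b : AffineBasis T ℝ Space3 := ⟨(↑), hT, by rwa [Subtype.range_coe]⟩
  refine ⟨b.coord ⟨v, htT hv⟩, b.coord_apply_eq ⟨v, htT hv⟩, fun w hw hne => ?_⟩
  exact b.coord_apply_ne (i := ⟨v, htT hv⟩) (j := ⟨w, htT hw⟩) (by
    simpa [Subtype.ext_iff] using hne.symm)

theorem eq_zero_of_mem_convexHull {s : Set Space3} {β : Space3 →ᵃ[ℝ] ℝ}
    (hβ : ∀ w ∈ s, β w = 0) {z : Space3} (hz : z ∈ convexHull ℝ s) : β z = 0 := by
  have : convexHull ℝ s ⊆ β ⁻¹' {0} :=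
    convexHull_min hβ ((convex_singleton (0 : ℝ)).affine_preimage β)
  exact this hz

theorem nonneg_of_mem_convexHull {s : Set Space3} {β : Space3 →ᵃ[ℝ] ℝ}
    (hβ : ∀ w ∈ s, 0 ≤ β w) {z : Space3} (hz : z ∈ convexHull ℝ s) : 0 ≤ β z := by
  have : convexHull ℝ s ⊆ β ⁻¹' Ici 0 :=
    convexHull_min hβ ((convex_Ici (0 : ℝ)).affine_preimage β)
  exact this hz

/-- A point of a simplex is outside the facet opposite to `v`, if its coordinate with respect
to `v` is not zero. -/
theorem notMem_convexHull_of_ne_zero {s : Set Space3} {β : Space3 →ᵃ[ℝ] ℝ} {z : Space3}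
    (hβ : ∀ w ∈ s, β w = 0) (hz : β z ≠ 0) : z ∉ convexHull ℝ s :=
  fun h => hz (eq_zero_of_mem_convexHull hβ h)

theorem isClosed_convexHull_finset (t : Finset Space3) :
    IsClosed (convexHull ℝ (t : Set Space3)) :=
  (t.finite_toSet.isCompact_convexHull ℝ).isClosed

theorem isClosed_carrier (F : Finset (Finset Space3)) : IsClosed (carrier F) :=
  isClosed_biUnion_finset fun s _ => isClosed_convexHull_finset s

theorem mem_carrier {F : Finset (Finset Space3)} {x : Space3} :
    x ∈ carrier F ↔ ∃ s ∈ F, x ∈ convexHull ℝ (s : Set Space3) := by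
  simp [carrier]

/-- A small ball around a point only meets the simplices that contain this point. -/
theorem exists_ball_inter_convexHull (T : Finset (Finset Space3)) (y : Space3) :
    ∃ ε > 0, ∀ t ∈ T, ∀ z ∈ ball y ε, z ∈ convexHull ℝ (t : Set Space3) →
      y ∈ convexHull ℝ (t : Set Space3) := by
  classical
  have hcl : IsClosed (carrier (T.filter fun t => y ∉ convexHull ℝ (t : Set Space3))) :=
    isClosed_carrier _
  have hy : y ∈ (carrier (T.filter fun t => y ∉ convexHull ℝ (t : Set Space3)))ᶜ := by
    rw [mem_compl_iff, mem_carrier]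
    rintro ⟨s, hs, hys⟩
    exact (Finset.mem_filter.1 hs).2 hys
  obtain ⟨ε, hε, hball⟩ := Metric.isOpen_iff.1 hcl.isOpen_compl y hy
  refine ⟨ε, hε, fun t ht z hz hzt => ?_⟩
  by_contra hyt
  exact hball hz (mem_carrier.2 ⟨t, Finset.mem_filter.2 ⟨ht, hyt⟩, hzt⟩)

namespace IsSimplicialFamily

variable {n : ℕ} {T : Finset (Finset Space3)}

/-- A simplex that contains a point of another one contains the face supporting this point. -/
theorem subset_of_mem_convexHull [DecidableEq Space3] (hT : IsSimplicialFamily n T)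
    {t t' e : Finset Space3} (ht : t ∈ T) (ht' : t' ∈ T) {y : Space3}
    (hy : y ∈ convexHull ℝ (t : Set Space3))
    (he : ∀ v ∈ e, y ∉ convexHull ℝ ((t.erase v : Finset Space3) : Set Space3))
    (hy' : y ∈ convexHull ℝ (t' : Set Space3)) : e ⊆ t' := by
  intro v hv
  by_contra hvt
  refine he v hv (convexHull_mono ?_ (hT.inter_subset t ht t' ht' ⟨hy, hy'⟩))
  rintro w ⟨hw, hw'⟩
  rw [Finset.mem_coe, Finset.mem_erase]
  exact ⟨fun h => hvt (h ▸ hw'), hw⟩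

/-- Every triangle has a centre, seen from which the whole triangle apart from its boundary
is free of the boundary. -/
theorem exists_centre [DecidableEq Space3] (hT : IsSimplicialFamily 3 T) {t : Finset Space3}
    (ht : t ∈ T) :
    ∃ c ∈ convexHull ℝ (t : Set Space3), ∀ z ∈ convexHull ℝ (t : Set Space3), ∀ τ : ℝ,
      0 ≤ τ → τ < 1 → ∀ v ∈ t,
        AffineMap.lineMap c z τ ∉ convexHull ℝ ((t.erase v : Finset Space3) : Set Space3) := by
  obtain ⟨p, q, w, -, -, -, heq⟩ := Finset.card_eq_three.1 (hT.card_eq t ht)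
  have hconv := convex_convexHull ℝ (t : Set Space3)
  have hmem : ∀ v ∈ t, v ∈ convexHull ℝ (t : Set Space3) := fun v hv => subset_convexHull ℝ _ hv
  have hp : p ∈ t := by simp [heq]
  have hq : q ∈ t := by simp [heq]
  have hw : w ∈ t := by simp [heq]
  have hm := hconv.lineMap_mem (hmem p hp) (hmem q hq) (t := (1 / 2 : ℝ)) (by norm_num)
  -- The centroid: its barycentric coordinates are positive and stay so on the way to `z`, short of
  -- `z` itself.
  refine ⟨AffineMap.lineMap w (AffineMap.lineMap p q (1 / 2 : ℝ)) (2 / 3 : ℝ),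
    hconv.lineMap_mem (hmem w hw) hm (by norm_num), ?_⟩
  intro z hz τ hτ0 hτ1 v hv
  obtain ⟨β, hβv, hβ⟩ := exists_barycentricCoord (hT.indep t ht) hv
  have hnn : ∀ x ∈ t, 0 ≤ β x := fun x hx => by
    rcases eq_or_ne x v with rfl | hne
    · rw [hβv]; norm_num
    · rw [hβ x hx hne]
  refine notMem_convexHull_of_ne_zero (β := β) (fun x hx => ?_) ?_
  · obtain ⟨hne, hx⟩ := Finset.mem_erase.1 hx
    exact hβ x hx hne
  · have hz0 : 0 ≤ β z := nonneg_of_mem_convexHull hnn hz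
    have hc : 0 < β (AffineMap.lineMap w (AffineMap.lineMap p q (1 / 2 : ℝ)) (2 / 3 : ℝ)) := by
      rw [AffineMap.apply_lineMap, AffineMap.apply_lineMap]
      simp only [AffineMap.lineMap_apply_module', smul_eq_mul]
      have h1 := hnn p hp
      have h2 := hnn q hq
      have h3 := hnn w hw
      have : v = p ∨ v = q ∨ v = w := by simpa [heq] using hv
      rcases this with rfl | rfl | rfl <;> linarith
    rw [AffineMap.apply_lineMap, AffineMap.lineMap_apply_module, smul_eq_mul, smul_eq_mul]
    have : 0 < (1 - τ) * β (AffineMap.lineMap w (AffineMap.lineMap p q (1 / 2 : ℝ)) (2 / 3 : ℝ)) :=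
      mul_pos (by linarith) hc
    have : 0 ≤ τ * β z := mul_nonneg hτ0 hz0
    linarith

end IsSimplicialFamily

namespace IsThinPair

variable {a b : Set Space3} {𝓔 : Finset (Finset Space3)} {T : Finset (Finset Space3)}

theorem notMem_inter_of_notMem_edges [DecidableEq Space3] (h : IsThinPair a b 𝓔)
    (hT : IsSimplicialFamily 3 T) (hTM : carrier T = frontier (a ∪ b)) {t : Finset Space3}
    (ht : t ∈ T) {x : Space3} (hx : x ∈ convexHull ℝ (t : Set Space3))
    (hxe : ∀ v ∈ t, x ∉ convexHull ℝ ((t.erase v : Finset Space3) : Set Space3)) :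
    x ∉ a ∩ b := by
  obtain ⟨ε, hε, hball⟩ := exists_ball_inter_convexHull T x
  refine h.notMem_inter_of_frontier_subset_plane hε
    (affineSpan_ne_top_of_card_le (hT.card_eq t ht).le) (convexHull_subset_affineSpan _ hx) ?_
  rintro z ⟨hzM, hz⟩
  rw [← hTM, mem_carrier] at hzM
  obtain ⟨t', ht', hzt'⟩ := hzM
  have hsub := hT.subset_of_mem_convexHull ht ht' hx hxe (hball t' ht' z hz hzt')
  have : t = t' := Finset.eq_of_subset_of_card_le hsub
    (by rw [hT.card_eq t ht, hT.card_eq t' ht'])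
  rw [← this] at hzt'
  exact convexHull_subset_affineSpan _ hzt'

/-- Every triangle of the frontier belongs to one of the two sets, and not to the other one. -/
theorem convexHull_subset_or (h : IsThinPair a b 𝓔) (hT : IsSimplicialFamily 3 T)
    (hTM : carrier T = frontier (a ∪ b)) {t : Finset Space3} (ht : t ∈ T) :
    (convexHull ℝ (t : Set Space3) ⊆ a ∨ convexHull ℝ (t : Set Space3) ⊆ b) ∧
      ¬ (convexHull ℝ (t : Set Space3) ⊆ a ∧ convexHull ℝ (t : Set Space3) ⊆ b) := by
  classical
  obtain ⟨c, hct, hc⟩ := hT.exists_centre ht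
  have hsub : convexHull ℝ (t : Set Space3) ⊆ a ∪ b := fun z hz =>
    (h.closed_left.union h.closed_right).frontier_subset
      (hTM ▸ mem_carrier.2 ⟨t, ht, hz⟩)
  have hin : ∀ z ∈ convexHull ℝ (t : Set Space3), ∀ τ : ℝ, 0 ≤ τ → τ < 1 →
      AffineMap.lineMap c z τ ∈ convexHull ℝ (t : Set Space3) := fun z hz τ h0 h1 =>
    (convex_convexHull ℝ _).lineMap_mem hct hz ⟨h0, h1.le⟩
  have hX : ∀ z ∈ convexHull ℝ (t : Set Space3), ∀ τ : ℝ, 0 ≤ τ → τ < 1 →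
      AffineMap.lineMap c z τ ∉ a ∩ b := fun z hz τ h0 h1 =>
    h.notMem_inter_of_notMem_edges hT hTM ht (hin z hz τ h0 h1) (hc z hz τ h0 h1)
  have hcX : c ∉ a ∩ b := by
    simpa using hX c hct 0 le_rfl one_pos
  have hcont : ∀ z : Space3, Continuous (AffineMap.lineMap c z : ℝ → Space3) :=
    fun z => AffineMap.lineMap_continuous
  -- The half-open segment from `c` to `z` is connected and avoids `a ∩ b`, so it stays in the set
  -- containing `c`; closedness adds `z`.
  have main : ∀ {a b : Set Space3}, IsClosed a → IsClosed b →
      convexHull ℝ (t : Set Space3) ⊆ a ∪ b →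
      (∀ z ∈ convexHull ℝ (t : Set Space3), ∀ τ : ℝ, 0 ≤ τ → τ < 1 →
        AffineMap.lineMap c z τ ∉ a ∩ b) → c ∈ a → convexHull ℝ (t : Set Space3) ⊆ a := by
    intro a b ha hb hab hX hca z hz
    have hpre : IsPreconnected (AffineMap.lineMap c z '' Ico (0 : ℝ) 1 : Set Space3) :=
      isPreconnected_Ico.image _ (hcont z).continuousOn
    have := isPreconnected_iff_subset_of_disjoint_closed.1 hpre a b ha hb
      (by
        rintro _ ⟨τ, ⟨h0, h1⟩, rfl⟩
        exact hab ((convex_convexHull ℝ _).lineMap_mem hct hz ⟨h0, h1.le⟩))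
      (by
        rw [eq_empty_iff_forall_notMem]
        rintro _ ⟨⟨τ, ⟨h0, h1⟩, rfl⟩, hτ⟩
        exact hX z hz τ h0 h1 hτ)
    have hc0 : c ∈ (AffineMap.lineMap c z '' Ico (0 : ℝ) 1 : Set Space3) :=
      ⟨0, by simp, by simp⟩
    have hsa : (AffineMap.lineMap c z '' Ico (0 : ℝ) 1 : Set Space3) ⊆ a := by
      refine this.resolve_right fun hsb => hX c hct 0 le_rfl one_pos ?_
      rw [AffineMap.lineMap_apply_zero]
      exact ⟨hca, hsb hc0⟩
    have hz1 : z = AffineMap.lineMap c z (1 : ℝ) := by simp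
    rw [hz1]
    refine closure_minimal hsa ha (image_closure_subset_closure_image (hcont z) ⟨1, ?_, rfl⟩)
    rw [closure_Ico zero_ne_one]
    simp
  refine ⟨?_, fun hab => hcX ⟨hab.1 hct, hab.2 hct⟩⟩
  rcases hsub hct with hca | hcb
  · exact .inl (main h.closed_left h.closed_right hsub hX hca)
  · refine .inr (main h.closed_right h.closed_left (by rwa [union_comm]) ?_ hcb)
    rwa [inter_comm]

/-- If all triangles through `y` belonged to `b`, the frontier of `a` near `y` would lie in `a ∩ b`,
hence in lines that cannot separate. -/
theorem exists_triangle_of_mem_frontier_left (h : IsThinPair a b 𝓔)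
    (hT : IsSimplicialFamily 3 T) (hTM : carrier T = frontier (a ∪ b)) {y : Space3}
    (hy : y ∈ frontier a) :
    ∃ t ∈ T, y ∈ convexHull ℝ (t : Set Space3) ∧ convexHull ℝ (t : Set Space3) ⊆ a := by
  by_contra! hno
  obtain ⟨ε, hε, hball⟩ := exists_ball_inter_convexHull T y
  refine not_isPreconnected_diff h.closed_left h.regular_left isOpen_ball (mem_ball_self hε)
    hy h.dense_compl ?_ (isPreconnected_diff_lines isOpen_ball (convex_ball y ε) 𝓔 h.card_le)
  rintro z ⟨hz, hzball⟩
  have hzM := h.frontier_left_subset hz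
  rw [← hTM, mem_carrier] at hzM
  obtain ⟨t, ht, hzt⟩ := hzM
  have hta := hno t ht (hball t ht z hzball hzt)
  exact h.inter_subset ⟨h.closed_left.frontier_subset hz,
    ((h.convexHull_subset_or hT hTM ht).1.resolve_left hta) hzt⟩

/-- Triangles sharing an edge that is in no third triangle belong to the same set. -/
theorem not_subset_of_common_edge [DecidableEq Space3] (h : IsThinPair a b 𝓔)
    (hT : IsSimplicialFamily 3 T) (hTM : carrier T = frontier (a ∪ b)) {t t' : Finset Space3}
    (ht : t ∈ T) (ht' : t' ∈ T) (hcard : (t ∩ t').card = 2)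
    (huniq : ∀ s ∈ T, t ∩ t' ⊆ s → s = t ∨ s = t') (hta : convexHull ℝ (t : Set Space3) ⊆ a) :
    ¬ convexHull ℝ (t' : Set Space3) ⊆ b := by
  intro htb
  obtain ⟨p, q, hpq, he⟩ := Finset.card_eq_two.1 hcard
  have hpt : p ∈ t ∩ t' := by simp [he]
  have hqt : q ∈ t ∩ t' := by simp [he]
  rw [Finset.mem_inter] at hpt hqt
  -- Only triangles containing the whole common edge pass through its midpoint, so near `y` the
  -- frontier of `a` lies in `t` alone.
  set y : Space3 := AffineMap.lineMap p q (1 / 2 : ℝ) with hy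
  have hymem : ∀ s : Finset Space3, p ∈ s → q ∈ s → y ∈ convexHull ℝ (s : Set Space3) :=
    fun s hp hq => (convex_convexHull ℝ _).lineMap_mem (subset_convexHull ℝ _ hp)
      (subset_convexHull ℝ _ hq) (by norm_num)
  have hyt := hymem t hpt.1 hqt.1
  have hysupp : ∀ v ∈ t ∩ t', y ∉ convexHull ℝ ((t.erase v : Finset Space3) : Set Space3) := by
    intro v hv
    obtain ⟨β, hβv, hβ⟩ := exists_barycentricCoord (hT.indep t ht) (Finset.mem_of_mem_inter_left hv)
    refine notMem_convexHull_of_ne_zero (β := β) (fun x hx => ?_) ?_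
    · obtain ⟨hne, hx⟩ := Finset.mem_erase.1 hx
      exact hβ x hx hne
    · rw [hy, AffineMap.apply_lineMap]
      rw [he, Finset.mem_insert, Finset.mem_singleton] at hv
      rcases hv with rfl | rfl
      · rw [hβv, hβ q hqt.1 hpq.symm]; norm_num [AffineMap.lineMap_apply_module]
      · rw [hβv, hβ p hpt.1 hpq]; norm_num [AffineMap.lineMap_apply_module]
  obtain ⟨w, hw, hwt'⟩ : ∃ w ∈ t, w ∉ t ∩ t' := by
    by_contra! hsub
    have := Finset.card_le_card (show t ⊆ t ∩ t' from hsub)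
    rw [hT.card_eq t ht] at this
    omega
  have hwp : p ≠ w := fun hh => hwt' (by simp [he, hh])
  have hwq : q ≠ w := fun hh => hwt' (by simp [he, hh])
  obtain ⟨β, hβw, hβ⟩ := exists_barycentricCoord (hT.indep t ht) hw
  have hβy : β y = 0 := by
    rw [hy, AffineMap.apply_lineMap, hβ p hpt.1 hwp, hβ q hqt.1 hwq]
    simp
  obtain ⟨ε, hε, hball⟩ := exists_ball_inter_convexHull T y
  -- The half-plane of `t` bounded by the line of the common edge.
  set N : Set Space3 := {z | z ∈ affineSpan ℝ (t : Set Space3) ∧ 0 ≤ β z} with hN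
  have hyfr : y ∈ frontier a := h.mem_frontier_left ⟨hta hyt, htb (hymem t' hpt.2 hqt.2)⟩
  refine not_isPreconnected_diff (N := N) h.closed_left h.regular_left isOpen_ball
    (mem_ball_self hε) hyfr ?_ ?_ ?_
  · refine (dense_compl_affineSubspace
      (affineSpan_ne_top_of_card_le (hT.card_eq t ht).le)).mono ?_
    exact compl_subset_compl.2 fun z hz => hz.1
  · rintro z ⟨hz, hzball⟩
    obtain ⟨s, hs, hzs, hsa⟩ := h.exists_triangle_of_mem_frontier_left hT hTM hz
    have hst : s = t := by
      refine (huniq s hs (hT.subset_of_mem_convexHull ht hs hyt hysupp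
        (hball s hs z hzball hzs))).resolve_right ?_
      rintro rfl
      exact (h.convexHull_subset_or hT hTM hs).2 ⟨hsa, htb⟩
    rw [hst] at hzs
    refine ⟨convexHull_subset_affineSpan _ hzs, nonneg_of_mem_convexHull (fun x hx => ?_) hzs⟩
    rcases eq_or_ne x w with rfl | hne
    · rw [hβw]; norm_num
    · rw [hβ x hx hne]
  -- A point `o` of the plane of `t` just beyond the edge sees the whole ball minus the half-plane,
  -- which is therefore star-shaped.
  · have hlim : Filter.Tendsto (fun r : ℝ => (AffineMap.lineMap y w (-r) : Space3))
        (nhdsWithin 0 (Ioi 0)) (nhds y) := by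
      have hc : Continuous (fun r : ℝ => (AffineMap.lineMap y w (-r) : Space3)) :=
        AffineMap.lineMap_continuous.comp continuous_neg
      have := hc.tendsto 0
      rw [neg_zero, AffineMap.lineMap_apply_zero] at this
      exact this.mono_left nhdsWithin_le_nhds
    obtain ⟨r, hr, hr0⟩ := ((hlim.eventually (ball_mem_nhds y hε)).and
      self_mem_nhdsWithin).exists
    set o : Space3 := AffineMap.lineMap y w (-r) with ho
    have hoN : o ∈ affineSpan ℝ (t : Set Space3) :=
      AffineMap.lineMap_mem _ (convexHull_subset_affineSpan _ hyt) (subset_affineSpan ℝ _ hw)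
    have hβo : β o = -r := by
      rw [ho, AffineMap.apply_lineMap, hβw, hβy]
      simp [AffineMap.lineMap_apply_module]
    refine (StarConvex.isPathConnected (a := o) ?_ ?_).isConnected.isPreconnected
    · rw [starConvex_iff_segment_subset]
      intro z hz x hx
      refine ⟨(convex_ball y ε).segment_subset hr hz.1 hx, fun hxN => hz.2 ?_⟩
      rw [segment_symm, segment_eq_image_lineMap] at hx
      obtain ⟨τ, ⟨hτ0, hτ1⟩, rfl⟩ := hx
      have hβx := hxN.2
      rw [AffineMap.apply_lineMap, AffineMap.lineMap_apply_module, hβo, smul_eq_mul,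
        smul_eq_mul] at hβx
      have hτ : τ ≠ 1 := by
        rintro rfl
        linarith
      have hτ' : 0 < 1 - τ := sub_pos.2 (lt_of_le_of_ne hτ1 hτ)
      refine ⟨mem_of_lineMap_mem hτ hoN hxN.1, ?_⟩
      by_contra! hneg
      nlinarith [mul_neg_of_pos_of_neg hτ' hneg, mul_nonneg hτ0 hr0.le]
    · refine ⟨hr, fun hh => ?_⟩
      have := hh.2
      linarith

/-- The union of two regular closed sets that meet in finitely many lines is not
bounded by a closed surface, unless the sets are disjoint. -/
theorem inter_eq_empty (h : IsThinPair a b 𝓔) (hM : IsClosedPLSurface (frontier (a ∪ b))) :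
    a ∩ b = ∅ := by
  classical
  obtain ⟨T, hT, hTM, hedge, hvert⟩ := hM
  rw [eq_empty_iff_forall_notMem]
  intro x hx
  obtain ⟨t, ht, hxt, hta⟩ :=
    h.exists_triangle_of_mem_frontier_left hT hTM (h.mem_frontier_left hx)
  obtain ⟨t', ht', hxt', htb'⟩ :=
    h.symm.exists_triangle_of_mem_frontier_left hT (by rwa [union_comm])
      (h.symm.mem_frontier_left hx.symm)
  -- Both triangles contain `x`, hence share a vertex. Membership in `a` then spreads along the
  -- triangles around it from `t` to `t'`.
  have hne : ((t : Set Space3) ∩ (t' : Set Space3)).Nonempty := by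
    rw [← convexHull_nonempty_iff (𝕜 := ℝ)]
    exact ⟨x, hT.inter_subset t ht t' ht' ⟨hxt, hxt'⟩⟩
  obtain ⟨v, hvt, hvt'⟩ := hne
  have hchain := hvert v t ht t' ht' hvt hvt'
  have hall : convexHull ℝ (t' : Set Space3) ⊆ a := by
    clear hxt' htb' hvt'
    induction hchain with
    | refl => exact hta
    | @tail s s' _ hss' ih =>
      obtain ⟨hs, hs', -, -, hcard⟩ := hss'
      have ihs := ih hs
      rw [← Finset.coe_inter, Set.ncard_coe_finset] at hcard
      refine ((h.convexHull_subset_or hT hTM hs').1).resolve_right ?_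
      refine h.not_subset_of_common_edge hT hTM hs hs' hcard (fun r hr hsub => ?_) ihs
      have hss : s ≠ s' := by
        rintro rfl
        rw [Finset.inter_self, hT.card_eq s hs] at hcard
        omega
      obtain ⟨r₁, r₂, -, hr₁₂⟩ := Set.ncard_eq_two.1
        (hedge (s ∩ s') hcard ⟨s, hs, Finset.inter_subset_left⟩)
      have h1 : s ∈ ({r₁, r₂} : Set (Finset Space3)) := by
        rw [← hr₁₂]; exact ⟨hs, Finset.inter_subset_left⟩
      have h2 : s' ∈ ({r₁, r₂} : Set (Finset Space3)) := by
        rw [← hr₁₂]; exact ⟨hs', Finset.inter_subset_right⟩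
      have h3 : r ∈ ({r₁, r₂} : Set (Finset Space3)) := by
        rw [← hr₁₂]; exact ⟨hr, hsub⟩
      simp only [mem_insert_iff, mem_singleton_iff] at h1 h2 h3
      grind
  exact (h.convexHull_subset_or hT hTM ht').2 ⟨hall, htb'⟩

end IsThinPair

end Beacon

/-! ### Facet connectivity and routing -/

namespace Beacon

theorem exists_isFacetTree {V : Type*} [DecidableEq V] {F : Finset (Finset V)}
    (hne : F.Nonempty)
    (hcut : ∀ A ⊆ F, A.Nonempty → A ≠ F → ∃ s ∈ A, ∃ t ∈ F \ A, (s ∩ t).card = 3) :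
    ∀ k, k + 1 ≤ F.card → ∃ u C, IsFacetTree u C ∧ C ⊆ F ∧ C.card = k + 1 := by
  intro k
  induction k with
  | zero =>
    intro _
    obtain ⟨u, hu⟩ := hne
    exact ⟨u, {u}, .single u, by simpa using hu, by simp⟩
  | succ k ih =>
    intro hk
    obtain ⟨u, C, hC, hCF, hcard⟩ := ih (by omega)
    obtain ⟨s, hs, t, ht, hst⟩ := hcut C hCF ⟨u, hC.root_mem⟩ (by rintro rfl; omega)
    rw [Finset.mem_sdiff] at ht
    have hd : Disjoint C {t} := Finset.disjoint_singleton_right.2 ht.2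
    refine ⟨u, C ∪ {t}, hC.attach hs (.single t) hst hd, ?_, ?_⟩
    · exact Finset.union_subset hCF (by simpa using ht.1)
    · rw [Finset.card_union_of_disjoint hd, hcard, Finset.card_singleton]

theorem exists_isConnectedTransversal {V : Type*} [DecidableEq V] {F : Finset (Finset V)}
    (hF : ∀ s ∈ F, s.card = 4) (h2 : 2 ≤ F.card)
    (hcut : ∀ A ⊆ F, A.Nonempty → A ≠ F → ∃ s ∈ A, ∃ t ∈ F \ A, (s ∩ t).card = 3) :
    ∃ B ⊆ F.sup id, 3 * B.card ≤ F.card + 1 ∧ IsConnectedTransversal B F := by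
  -- The tree omits one tetrahedron `l`. The free point taken in `d ∩ l` also hits `l`, and `3 *
  -- B.card + 1 ≤ F.card - 1` leaves room for it.
  obtain ⟨u, C, hC, hCF, hcard⟩ := exists_isFacetTree (Finset.card_pos.1 (by omega)) hcut
    (F.card - 2) (by omega)
  obtain ⟨d, hd, l, hl, hdl⟩ := hcut C hCF ⟨u, hC.root_mem⟩ (by rintro rfl; omega)
  rw [Finset.mem_sdiff] at hl
  obtain ⟨B, e, he, r, h1, h3, her, hB, hBC, hx⟩ := (hC.reroot hd).exists_transversal
    (fun s hs => hF s (hCF hs)) (Finset.inter_subset_left : d ∩ l ⊆ d) hdl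
  obtain ⟨x, hxe⟩ := Finset.card_pos.1 (show 0 < e.card by omega)
  have hxdl := Finset.mem_inter.1 (he hxe)
  have hFC : F = C ∪ {l} := by
    refine (Finset.eq_of_subset_of_card_le
      (Finset.union_subset hCF (by simpa using hl.1)) ?_).symm
    rw [Finset.card_union_of_disjoint (Finset.disjoint_singleton_right.2 hl.2), hcard,
      Finset.card_singleton]
    omega
  refine ⟨insert x B, ?_, ?_, ?_⟩
  · refine Finset.insert_subset ?_ (hBC.trans (Finset.sup_mono hCF))
    exact Finset.le_sup (f := id) (hCF hd) hxdl.1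
  · have := Finset.card_insert_le x B
    omega
  · have := (hx x hxe).union (x := x)
      (isConnectedTransversal_singleton (S := {x}) (u := l) (by simpa using hxdl.2)
        (Finset.singleton_nonempty x)) (by simp) (by simp)
    rw [hFC]
    convert this using 1
    ext z
    simp

theorem IsSimplicialFamily.carrier_subset_closure_interior {F A : Finset (Finset Space3)}
    (hF : IsSimplicialFamily 4 F) (hA : A ⊆ F) :
    carrier A ⊆ closure (interior (carrier A)) := by
  intro x hx
  obtain ⟨s, hs, hxs⟩ := mem_carrier.1 hx
  have hne : (interior (convexHull ℝ (s : Set Space3))).Nonempty := by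
    rw [interior_convexHull_nonempty_iff_affineSpan_eq_top]
    have := (hF.indep s (hA hs)).affineSpan_eq_top_iff_card_eq_finrank_add_one
    rw [Subtype.range_coe] at this
    exact this.2 (by simp [hF.card_eq s (hA hs)])
  have hcl := (convex_convexHull ℝ (s : Set Space3)).closure_interior_eq_closure_of_nonempty_interior
    hne
  have hx' : x ∈ closure (interior (convexHull ℝ (s : Set Space3))) := by
    rw [hcl]; exact subset_closure hxs
  exact closure_mono (interior_mono fun z hz => mem_carrier.2 ⟨s, hs, hz⟩) hx'

theorem carrier_union [DecidableEq Space3] (A B : Finset (Finset Space3)) :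
    carrier (A ∪ B) = carrier A ∪ carrier B := by
  ext x
  simp only [mem_carrier, Finset.mem_union, Set.mem_union]
  grind

/-- The tetrahedra of a polyhedron are connected to each other through common facets. -/
theorem IsTetrahedralDecomposition.exists_common_facet [DecidableEq Space3] {P : Set Space3}
    {F : Finset (Finset Space3)} (hF : IsTetrahedralDecomposition P F) (hP : IsPolyhedron P)
    {A : Finset (Finset Space3)} (hA : A ⊆ F) (hne : A.Nonempty) (hAF : A ≠ F) :
    ∃ s ∈ A, ∃ t ∈ F \ A, (s ∩ t).card = 3 := by
  by_contra! hno
  have hS := hF.simplicial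
  have hcard : ∀ s ∈ A, ∀ t ∈ F \ A, (s ∩ t).card ≤ 2 := by
    intro s hs t ht
    have h3 := hno s hs t ht
    have hle := Finset.card_le_card (Finset.inter_subset_left : s ∩ t ⊆ s)
    rw [hS.card_eq s (hA hs)] at hle
    rw [Finset.mem_sdiff] at ht
    have h4 : (s ∩ t).card ≠ 4 := by
      intro h4
      have e₁ := Finset.eq_of_subset_of_card_le (Finset.inter_subset_left : s ∩ t ⊆ s)
        (by rw [hS.card_eq s (hA hs), h4])
      have e₂ := Finset.eq_of_subset_of_card_le (Finset.inter_subset_right : s ∩ t ⊆ t)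
        (by rw [hS.card_eq t ht.1, h4])
      exact ht.2 (e₂ ▸ e₁.symm ▸ hs)
    omega
  have hpair : IsThinPair (carrier A) (carrier (F \ A))
      (Finset.image₂ (fun s t => s ∩ t) A (F \ A)) := by
    refine ⟨isClosed_carrier _, isClosed_carrier _, hS.carrier_subset_closure_interior hA,
      hS.carrier_subset_closure_interior Finset.sdiff_subset, ?_, ?_⟩
    · intro e he
      obtain ⟨s, hs, t, ht, rfl⟩ := Finset.mem_image₂.1 he
      exact hcard s hs t ht
    · rintro x ⟨hxA, hxB⟩
      obtain ⟨s, hs, hxs⟩ := mem_carrier.1 hxA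
      obtain ⟨t, ht, hxt⟩ := mem_carrier.1 hxB
      simp only [Set.mem_iUnion]
      refine ⟨s ∩ t, Finset.mem_image₂_of_mem hs ht, ?_⟩
      rw [Finset.coe_inter]
      exact convexHull_subset_affineSpan _
        (hS.inter_subset s (hA hs) t (Finset.mem_sdiff.1 ht).1 ⟨hxs, hxt⟩)
  have hunion : carrier A ∪ carrier (F \ A) = P := by
    rw [← carrier_union, Finset.union_sdiff_of_subset hA, hF.carrier_eq]
  have hdisj := hpair.inter_eq_empty (by rw [hunion]; exact hP.boundary)
  have hnonempty : ∀ {C : Finset (Finset Space3)}, C ⊆ F → C.Nonempty →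
      (carrier C).Nonempty := by
    rintro C hC ⟨s, hs⟩
    obtain ⟨v, hv⟩ := Finset.card_pos.1 (show 0 < s.card by rw [hS.card_eq s (hC hs)]; norm_num)
    exact ⟨v, mem_carrier.2 ⟨s, hs, subset_convexHull ℝ _ hv⟩⟩
  have hBne : (F \ A).Nonempty := by
    rw [Finset.sdiff_nonempty]
    exact fun h => hAF (hA.antisymm h)
  obtain ⟨x, hx⟩ := hnonempty hA hne
  obtain ⟨y, hy⟩ := hnonempty Finset.sdiff_subset hBne
  -- A connected set is not the union of two disjoint nonempty closed sets.
  obtain ⟨z, -, hz⟩ := isPreconnected_closed_iff.1 hP.isConnected.isPreconnected _ _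
    (isClosed_carrier A) (isClosed_carrier (F \ A)) hunion.ge
    ⟨x, by rw [← hunion]; exact .inl hx, hx⟩ ⟨y, by rw [← hunion]; exact .inr hy, hy⟩
  rw [hdisj] at hz
  exact hz

theorem covers_of_mem_convexHull {F : Finset (Finset Space3)} {s : Finset Space3} (hs : s ∈ F)
    {x y : Space3} (hx : x ∈ convexHull ℝ (s : Set Space3))
    (hy : y ∈ convexHull ℝ (s : Set Space3)) : Covers (carrier F) y x :=
  covers_of_segment_subset (((convex_convexHull ℝ _).segment_subset hx hy).trans
    fun _ hz => mem_carrier.2 ⟨s, hs, hz⟩)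

theorem IsConnectedTransversal.canRoute {F : Finset (Finset Space3)} {B : Finset Space3}
    (hB : IsConnectedTransversal B F) {p q : Space3} (hp : p ∈ carrier F) (hq : q ∈ carrier F) :
    CanRoute (carrier F) B p q := by
  obtain ⟨s, hs, hps⟩ := mem_carrier.1 hp
  obtain ⟨t, ht, hqt⟩ := mem_carrier.1 hq
  obtain ⟨b, hb, hbs⟩ := hB.1 s hs
  obtain ⟨c, hc, hct⟩ := hB.1 t ht
  refine .of_covers hb (covers_of_mem_convexHull hs hps (subset_convexHull ℝ _ hbs)) ?_
  have hpath := hB.2 b hb c hc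
  clear hbs hb
  induction hpath using Relation.ReflTransGen.head_induction_on with
  | refl => exact canRoute_of_covers (covers_of_mem_convexHull ht (subset_convexHull ℝ _ hct) hqt)
  | head h _ ih =>
    obtain ⟨hy, r, hr, hxr, hyr⟩ := h
    exact .of_covers hy (covers_of_mem_convexHull hr (subset_convexHull ℝ _ hxr)
      (subset_convexHull ℝ _ hyr)) ih

end Beacon

theorem mainTheorem2 (P : Set Beacon.Space3) (hP : Beacon.IsPolyhedron P)
    (F : Finset (Finset Beacon.Space3)) (hF : Beacon.IsTetrahedralDecomposition P F) :
    ∃ B : Finset Beacon.Space3, (B : Set Beacon.Space3) ⊆ P ∧ B.card ≤ (F.card + 1) / 3 ∧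
      ∀ p ∈ P, ∀ q ∈ P, Beacon.CanRoute P B p q := by
  classical
  rcases Nat.lt_or_ge F.card 2 with h2 | h2
  · refine ⟨∅, by simp, by simp, fun p hp q hq => Beacon.canRoute_of_covers ?_⟩
    rw [← hF.carrier_eq] at hp hq ⊢
    obtain ⟨s, hs, hps⟩ := Beacon.mem_carrier.1 hp
    obtain ⟨t, ht, hqt⟩ := Beacon.mem_carrier.1 hq
    obtain rfl : s = t := Finset.card_le_one.1 (by omega) s hs t ht
    exact Beacon.covers_of_mem_convexHull hs hps hqt
  · obtain ⟨B, hBF, hcard, hB⟩ := Beacon.exists_isConnectedTransversal hF.simplicial.card_eq h2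
      fun A hA hne hAF => hF.exists_common_facet hP hA hne hAF
    refine ⟨B, fun b hb => ?_, by omega, fun p hp q hq => ?_⟩
    · obtain ⟨s, hs, hbs⟩ := Finset.mem_sup.1 (hBF hb)
      rw [← hF.carrier_eq]
      exact Beacon.mem_carrier.2 ⟨s, hs, subset_convexHull ℝ _ hbs⟩
    · rw [← hF.carrier_eq] at hp hq ⊢
      exact hB.canRoute hp hq
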